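/- **Theorem 1 (Randomized SVD for Hilbert–Schmidt operators).** Let $D_1,D_2\subseteq\mathbb{R}^d$ be measurable sets (for example domains) and let $\mathscr{F}:L^2(D_1)\to L^2(D_2)$ be a Hilbert–Schmidt (HS) operator, that is, a bounded linear operator with $\|\mathscr{F}\|_{\rm HS}=\big(\sum_{j\ge1}\|\mathscr{F}e_j\|^2\big)^{1/2}<\infty$ for a complete orthonormal basis $(e_j)$ of $L^2(D_1)$. Let $\mathscr{F}f=\sum_{j\ge1}\sigma_j\langle v_j,f\rangle u_j$ be a singular value decomposition of $\mathscr{F}$, with singular values $\sigma_1\ge\sigma_2\ge\cdots\ge0$ and orthonormal families of right singular functions $v_j\in L^2(D_1)$ and left singular functions $u_j\in L^2(D_2)$. Let $K:D_1\times D_1\to\mathbb{R}$ be a continuous symmetric positive definite kernel, meaning that all matrices $(K(x_i,x_j))_{i,j}$ are positive semidefinite and $\int_{D_1\times D_1} f(x)K(x,y)f(y)\,dx\,dy>0$ for all nonzero $f\in L^2(D_1)$. Suppose that it has finite trace, $\int_{D_1}K(x,x)\,dx<\infty$, and let $\lambda_1\ge\lambda_2\ge\cdots$ be the eigenvalues,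 with multiplicity, of the integral operator on $L^2(D_1)$ with kernel $K$. Let $k\ge1$ and $p\ge2$ be integers, let $\omega_1,\dots,\omega_{k+p}$ be (the $L^2(D_1)$ classes of the paths of) independent jointly measurable Gaussian processes on $D_1$ with mean $0$ and covariance $K$, and put $Y=\mathscr{F}\Omega=[\mathscr{F}\omega_1\,|\cdots|\,\mathscr{F}\omega_{k+p}]$. Let $P_Y$ be the orthogonal projection of $L^2(D_2)$ onto the linear span of the columns of $Y$. Let $$C_{ij}=\int_{D_1\times D_1}v_i(x)K(x,y)v_j(y)\,dx\,dy\quad(1\le i,j\le k),\qquad \gamma_k=\frac{k}{\lambda_1\,\mathrm{Tr}(C^{-1})}.$$ Then all $\lambda_j$ are positive, $\sum_j\lambda_j<\infty$, $\sum_j\sigma_j^2<\infty$, the matrix $C$ is symmetric positive definite, the random variable $\|\mathscr{F}-P_Y\mathscr{F}\|_{\rm HS}$ is integrable, and $$\mathbb{E}\,\|\mathscr{F}-P_Y\mathscr{F}\|_{\rm HS}\le\left(1+\sqrt{\frac1{\gamma_k}\,\frac{k(k+p)}{p-1}}\right)\left(\sum_{j=k+1}^\infty\sigma_j^2\right)^{1/2}.$$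 If moreover $p\ge4$, then for all real $s,t\ge1$ the inequality $$\|\mathscr{F}-P_Y\mathscr{F}\|_{\rm HS}\le\sqrt{1+t^2s^2\,\frac3{\gamma_k}\,\frac{k(k+p)}{p+1}\sum_{j=1}^\infty\frac{\lambda_j}{\lambda_1}}\;\left(\sum_{j=k+1}^\infty\sigma_j^2\right)^{1/2}$$ holds with probability at least $1-t^{-p}-\big[s\,e^{-(s^2-1)/2}\big]^{k+p}$. -/

import Mathlib

open MeasureTheory ProbabilityTheory

noncomputable section

namespace RandSVD

/-- Points of `ℝ^d` with the Euclidean structure. -/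
abbrev Pt (d : ℕ) : Type := EuclideanSpace ℝ (Fin d)

/-- Lebesgue measure on a (measurable) set `D ⊆ ℝ^d`. -/
abbrev leb {d : ℕ} (D : Set (Pt d)) : Measure D := (volume : Measure (Pt d)).comap Subtype.val

/-- The real Hilbert space `L²(D)` with respect to Lebesgue measure on `D ⊆ ℝ^d`. -/
abbrev L2 {d : ℕ} (D : Set (Pt d)) : Type := Lp ℝ 2 (leb D)

section HilbertSchmidt

variable {H₁ H₂ : Type*} [NormedAddCommGroup H₁] [InnerProductSpace ℝ H₁]
  [NormedAddCommGroup H₂] [InnerProductSpace ℝ H₂]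

/-- `F` is Hilbert–Schmidt: `∑ ‖F e_j‖² < ∞`, for the complete orthonormal basis `e`. -/
def IsHilbertSchmidt (e : HilbertBasis ℕ ℝ H₁) (F : H₁ →L[ℝ] H₂) : Prop :=
  Summable fun j => ‖F (e j)‖ ^ 2

/-- The Hilbert–Schmidt norm `(∑ ‖F e_j‖²)^{1/2}`, computed in the complete orthonormal
basis `e`. -/
def hsNorm (e : HilbertBasis ℕ ℝ H₁) (F : H₁ →L[ℝ] H₂) : ℝ :=
  Real.sqrt (∑' j, ‖F (e j)‖ ^ 2)

/-- A singular value decomposition `F f = ∑ σ_j ⟨v_j, f⟩ u_j` with singular values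
`σ_0 ≥ σ_1 ≥ ⋯ ≥ 0`, right singular vectors `v_j` and left singular vectors `u_j`.
The families `v`, `u` are orthonormal; they need not be complete (an operator that has infinitely
many nonzero singular values and a nontrivial kernel has no decomposition with `σ` nonincreasing
and `v` complete). -/
structure IsSVD (F : H₁ →L[ℝ] H₂) (σ : ℕ → ℝ) (v : ℕ → H₁) (u : ℕ → H₂) : Prop where
  antitone : Antitone σ
  nonneg : ∀ j, 0 ≤ σ j
  orthonormal_right : Orthonormal ℝ v
  orthonormal_left : Orthonormal ℝ u
  hasSum : ∀ f, HasSum (fun j => (σ j * inner ℝ (v j) f) • u j) (F f)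

/-- The column space of a quasimatrix with columns `Y_j`. -/
def colSpace {ℓ : ℕ} (Y : Fin ℓ → H₂) : Submodule ℝ H₂ := Submodule.span ℝ (Set.range Y)

instance {ℓ : ℕ} (Y : Fin ℓ → H₂) : FiniteDimensional ℝ (colSpace Y) :=
  FiniteDimensional.span_of_finite ℝ (Set.finite_range Y)

/-- `P_Y`, the orthogonal projection onto the space spanned by the columns of `Y`. -/
def projCol {ℓ : ℕ} (Y : Fin ℓ → H₂) : H₂ →L[ℝ] H₂ := (colSpace Y).starProjection

end HilbertSchmidt

section Kernel

variable {d : ℕ} {D : Set (Pt d)}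

/-- The bilinear form `∫_{D×D} f(x) K(x,y) g(y) dx dy` of a kernel on `L²(D)`. -/
def kernelForm (K : D → D → ℝ) (f g : L2 D) : ℝ :=
  ∫ z : D × D, f z.1 * K z.1 z.2 * g z.2 ∂((leb D).prod (leb D))

/-- A continuous symmetric positive definite kernel: it is positive semidefinite on finite sets of
points (so that it is a covariance function), and its integral operator is strictly positive on
`L²(D)` (so that all its eigenvalues are strictly positive). -/
structure IsPosDefKernel (K : D → D → ℝ) : Prop where
  continuous : Continuous (Function.uncurry K)
  symm : ∀ x y, K x y = K y x
  posSemidef : ∀ (n : ℕ) (x : Fin n → D) (c : Fin n → ℝ),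
    0 ≤ ∑ i, ∑ j, c i * c j * K (x i) (x j)
  posDef : ∀ f : L2 D, f ≠ 0 → 0 < kernelForm K f f

/-- `lam 0 ≥ lam 1 ≥ ⋯` is the sequence of all eigenvalues, with multiplicity, of the integral
operator with kernel `K`: they belong to a complete orthonormal basis of eigenfunctions. -/
def IsEigenvalueSeq (K : D → D → ℝ) (lam : ℕ → ℝ) : Prop :=
  Antitone lam ∧ ∃ ψ : HilbertBasis ℕ ℝ (L2 D),
    ∀ j, ∀ᵐ x ∂(leb D), ∫ y, K x y * ψ j y ∂(leb D) = lam j * ψ j x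

/-- The `k × k` matrix `C_ij = ∫_{D×D} v_i(x) K(x,y) v_j(y) dx dy`. -/
def covMatrix (K : D → D → ℝ) (v : ℕ → L2 D) (k : ℕ) : Matrix (Fin k) (Fin k) ℝ :=
  Matrix.of fun i j => kernelForm K (v i) (v j)

/-- The quality `γ_k = k / (λ₁ Tr(C⁻¹))` of the kernel; `lam 0` is the largest eigenvalue. -/
def quality (K : D → D → ℝ) (lam : ℕ → ℝ) (v : ℕ → L2 D) (k : ℕ) : ℝ :=
  k / (lam 0 * ((covMatrix K v k)⁻¹).trace)

variable {S : Type*} [MeasurableSpace S]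

/-- A (jointly measurable) Gaussian process on `D` with mean zero and covariance `K`, that is,
a process with distribution `GP(0, K)`. -/
structure IsCenteredGP (K : D → D → ℝ) (P : Measure S) (X : D → S → ℝ) : Prop where
  measurable : Measurable (Function.uncurry X)
  gaussian : IsGaussianProcess X P
  mean : ∀ x, ∫ w, X x w ∂P = 0
  cov : ∀ x y, covariance (X x) (X y) P = K x y

/-- `W` is a random `D × ℓ` quasimatrix whose columns are drawn independently from `GP(0, K)`:
the `j`-th column is almost surely the `L²(D)` class of the path of a process `X j`, and
`X 0, X 1, …` are independent with distribution `GP(0, K)`. -/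
def IsGPQuasimatrix (K : D → D → ℝ) (P : Measure S) {ℓ : ℕ} (W : Fin ℓ → S → L2 D) : Prop :=
  ∃ X : Fin ℓ → D → S → ℝ,
    (∀ j, IsCenteredGP K P (X j)) ∧
    iIndepFun (fun j (w : S) (x : D) => X j x w) P ∧
    ∀ j, ∀ᵐ w ∂P, (W j w : D → ℝ) =ᵐ[leb D] fun x => X j x w

end Kernel

/-- The approximation error `‖F - P_Y F‖_HS` with `Y = F Ω`, where `Ω` has the columns `om j`. -/
def svdError {H₁ H₂ : Type*} [NormedAddCommGroup H₁] [InnerProductSpace ℝ H₁]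
    [NormedAddCommGroup H₂] [InnerProductSpace ℝ H₂]
    (e : HilbertBasis ℕ ℝ H₁) (F : H₁ →L[ℝ] H₂) {ℓ : ℕ} (om : Fin ℓ → H₁) : ℝ :=
  hsNorm e (F - (projCol fun j => F (om j)) ∘L F)

end RandSVD

end

/-! Write `ω_l` for the columns of `Ω`, `ℓ = k + p`, `g_i ∈ ℝ^ℓ` for the vector of coefficients
`⟨v_i, ω_l⟩`, and `τ` for the tail sum of the `σ_j ^ 2` beyond the first `k`.

Deterministic part (`svdError_sq_le`). `F - P_Y F` vanishes wherever `F` does, so its squared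
Hilbert–Schmidt norm is the sum of `‖(1 - P_Y) F v_j‖ ^ 2`. The indices beyond the first `k`
contribute at most `τ`. For a leading index, `1 - P_Y` kills every `F ω_l`, so `v_j` may be replaced
by `v_j - ∑ m_l ω_l` for any `m`. Let `r_j` be the part of `g_j` orthogonal to the other leading
`g_i`. The choice `m = r_j / ‖r_j‖ ^ 2` removes all leading coefficients, and Cauchy–Schwarz bounds
the rest. Altogether the squared error is at most `τ + M R`, where `M = ∑ ‖r_j‖⁻²` over the leading
indices and `R = ∑ σ_i ^ 2 ‖g_i‖ ^ 2` over the tail.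

Probabilistic part. The pairings of the columns with elements of `L²` are centered Gaussian with
covariance form `B(f, g) = ∫∫ f K g`, independently over the columns. A combination of the leading
`v_i` that is `B`-orthogonal to all of them but `v_j` shows that `‖r_j‖ ^ 2 (C⁻¹)_jj` is the squared
distance of a standard Gaussian vector of `ℝ^(k+p)` from the span of `k - 1` vectors independent of
it. It therefore dominates a chi-square variable with `p + 1` degrees of freedom
(`lintegral_coeffResidual_rpow_neg_le`), whose negative moments are Gamma quotients. Since `B(f, f)
≤ λ₁ ‖f‖ ^ 2`, the mean of `R` is at most `(k + p) λ₁ τ`.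

`M` and `R` may be dependent, because `B` need not be diagonal in the `v_j`. The mean of `√(M R)` is
handled by Cauchy–Schwarz. The probability bound is a union bound: Markov for the moment of order `p
/ 2` of `M`, and a Chernoff bound for `R`, where Jensen reduces the exponential moment of the
weighted sum to those of single `‖g_i‖ ^ 2`.

Passage from processes to `L²`. A pairing of `h` with a path lies in the closed span of the process
in `L²(P)`, because Fubini makes it orthogonal to everything orthogonal to the process. Gaussianity
survives the closure because characteristic functions are `L²`-continuous. -/

namespace RandSVD

open scoped ENNReal

/-! ### Inverse moments of the chi-square distribution -/

theorem lintegral_rpow_mul_exp_neg {a c : ℝ} (ha : 0 < a) (hc : 0 < c) :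
    ∫⁻ t in Set.Ioi (0 : ℝ), ENNReal.ofReal (t ^ (a - 1) * Real.exp (-(c * t))) =
      ENNReal.ofReal (Real.Gamma a * c ^ (-a)) := by
  have h := Real.integral_rpow_mul_exp_neg_mul_Ioi ha hc
  have hpos : 0 < (1 / c) ^ a * Real.Gamma a := by
    have := Real.Gamma_pos_of_pos ha
    positivity
  rw [← ofReal_integral_eq_lintegral_ofReal]
  · rw [h, one_div, Real.inv_rpow hc.le, Real.rpow_neg hc.le, mul_comm]
  · by_contra hn
    have h0 := integral_undef hn
    rw [h] at h0
    exact hpos.ne' h0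
  · filter_upwards [ae_restrict_mem measurableSet_Ioi] with t ht
    have : 0 < t := ht
    positivity

/-- The Gamma integral turns a negative power into a mixture of exponentials. At `c = 0` the left
side is infinite, and so is the right, since `t ^ (q - 1)` is not integrable on the half line. -/
theorem ofReal_rpow_neg_le_lintegral {q c : ℝ} (hq : 0 < q) (hc : 0 ≤ c) :
    ENNReal.ofReal c ^ (-q) * ENNReal.ofReal (Real.Gamma q) ≤
      ∫⁻ t in Set.Ioi (0 : ℝ), ENNReal.ofReal (t ^ (q - 1) * Real.exp (-(c * t))) := by
  rcases hc.eq_or_lt with rfl | hc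
  · have : ∫⁻ t in Set.Ioi (0 : ℝ), ENNReal.ofReal (t ^ (q - 1) * Real.exp (-(0 * t))) = ∞ := by
      by_contra hne
      refine not_integrableOn_Ioi_rpow (q - 1) ⟨by fun_prop, ?_⟩
      rw [hasFiniteIntegral_iff_ofReal]
      · simpa using lt_top_iff_ne_top.2 hne
      · filter_upwards [ae_restrict_mem measurableSet_Ioi] with t ht
        have : 0 < t := ht
        positivity
    rw [this]
    exact le_top
  · rw [lintegral_rpow_mul_exp_neg hq hc, ENNReal.ofReal_rpow_of_pos hc,
      ← ENNReal.ofReal_mul (by positivity), mul_comm]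

theorem lintegral_exp_mul_sq_gaussianReal {a : ℝ} (ha : a < 1 / 2) :
    ∫⁻ x, ENNReal.ofReal (Real.exp (a * x ^ 2)) ∂(gaussianReal 0 1) =
      ENNReal.ofReal ((1 - 2 * a) ^ (-(1 / 2) : ℝ)) := by
  have hb : 0 < 1 / 2 - a := by linarith
  rw [gaussianReal_of_var_ne_zero 0 one_ne_zero,
    lintegral_withDensity_eq_lintegral_mul _ (measurable_gaussianPDF 0 1) (by fun_prop)]
  have hfun : ∀ x : ℝ, (gaussianPDF 0 1 * fun x : ℝ => ENNReal.ofReal (Real.exp (a * x ^ 2))) x =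
      ENNReal.ofReal ((√(2 * Real.pi))⁻¹ * Real.exp (-(1 / 2 - a) * x ^ 2)) := by
    intro x
    simp only [Pi.mul_apply, gaussianPDF, gaussianPDFReal]
    rw [← ENNReal.ofReal_mul (by positivity), mul_assoc, ← Real.exp_add]
    congr 3
    · simp
    · simp only [NNReal.coe_one]; ring
  simp_rw [hfun]
  rw [← ofReal_integral_eq_lintegral_ofReal
    ((integrable_exp_neg_mul_sq hb).const_mul _)
    (Filter.Eventually.of_forall fun x => by positivity),
    integral_const_mul, integral_gaussian, ← Real.sqrt_inv, ← Real.sqrt_mul (by positivity),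
    Real.rpow_neg (by linarith), ← Real.sqrt_eq_rpow, ← Real.sqrt_inv]
  congr 2
  have h1 : 1 - 2 * a ≠ 0 := by linarith
  field_simp

theorem lintegral_exp_mul_norm_sq_stdGaussian (n : ℕ) {a : ℝ} (ha : a < 1 / 2) :
    ∫⁻ x, ENNReal.ofReal (Real.exp (a * ‖x‖ ^ 2)) ∂(stdGaussian (EuclideanSpace ℝ (Fin n))) =
      ENNReal.ofReal ((1 - 2 * a) ^ (-(n / 2) : ℝ)) := by
  have hfun : ∀ x : Fin n → ℝ, ENNReal.ofReal (Real.exp (a * ‖WithLp.toLp 2 x‖ ^ 2)) =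
      ∏ i, ENNReal.ofReal (Real.exp (a * x i ^ 2)) := by
    intro x
    rw [EuclideanSpace.real_norm_sq_eq, Finset.mul_sum, Real.exp_sum,
      ENNReal.ofReal_prod_of_nonneg fun _ _ => by positivity]
  rw [← map_pi_eq_stdGaussian, lintegral_map (by fun_prop) (by fun_prop)]
  simp_rw [hfun]
  have hind : iIndepFun (fun (i : Fin n) (x : Fin n → ℝ) => ENNReal.ofReal (Real.exp (a * x i ^ 2)))
      (Measure.pi fun _ : Fin n => gaussianReal 0 1) :=
    iIndepFun_pi (X := fun _ y => ENNReal.ofReal (Real.exp (a * y ^ 2)))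
      fun i => by fun_prop
  rw [lintegral_prod_eq_prod_lintegral_of_indepFun _ _ hind fun i => by fun_prop]
  have hone : ∀ i : Fin n, ∫⁻ x : Fin n → ℝ, ENNReal.ofReal (Real.exp (a * x i ^ 2))
      ∂(Measure.pi fun _ : Fin n => gaussianReal 0 1) =
      ENNReal.ofReal ((1 - 2 * a) ^ (-(1 / 2) : ℝ)) := by
    intro i
    rw [← lintegral_exp_mul_sq_gaussianReal ha]
    exact (measurePreserving_eval (fun _ : Fin n => gaussianReal 0 1) i).lintegral_comp
      (f := fun y => ENNReal.ofReal (Real.exp (a * y ^ 2))) (by fun_prop)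
  simp_rw [hone]
  rw [Finset.prod_const, Finset.card_univ, Fintype.card_fin,
    ← ENNReal.ofReal_pow (Real.rpow_nonneg (by linarith) _), ← Real.rpow_natCast,
    ← Real.rpow_mul (by linarith)]
  congr 2
  ring

/-- The moment of order `-q` of a chi-square variable with `n` degrees of freedom. -/
noncomputable def invChiSqMoment (n : ℕ) (q : ℝ) : ℝ :=
  2 ^ (-q) * Real.Gamma (n / 2 - q) / Real.Gamma (n / 2)

/-- The density of the chi-square law is avoided: a Gamma integral replaces the negative power by
exponentials, whose Gaussian means factor over the coordinates. The condition `q < n / 2` makes the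
remaining integral finite. -/
theorem lintegral_norm_sq_rpow_neg_stdGaussian_le (n : ℕ) {q : ℝ} (hq : 0 < q)
    (hqn : q < n / 2) :
    ∫⁻ x, ENNReal.ofReal (‖x‖ ^ 2) ^ (-q) ∂(stdGaussian (EuclideanSpace ℝ (Fin n))) ≤
      ENNReal.ofReal (invChiSqMoment n q) := by
  set μ := stdGaussian (EuclideanSpace ℝ (Fin n))
  have hn : (0 : ℝ) < n / 2 := hq.trans hqn
  have hGq := Real.Gamma_pos_of_pos hq
  have hGn := Real.Gamma_pos_of_pos hn
  -- the Laplace transform of the chi-square distribution, integrated against `t ^ (q - 1)`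
  have h1 : (∫⁻ x, ENNReal.ofReal (‖x‖ ^ 2) ^ (-q) ∂μ) * ENNReal.ofReal (Real.Gamma q) ≤
      ∫⁻ t : ℝ in Set.Ioi 0, ENNReal.ofReal (t ^ (q - 1) * (1 + 2 * t) ^ (-(n / 2) : ℝ)) := by
    calc (∫⁻ x, ENNReal.ofReal (‖x‖ ^ 2) ^ (-q) ∂μ) * ENNReal.ofReal (Real.Gamma q)
        = ∫⁻ x, ENNReal.ofReal (‖x‖ ^ 2) ^ (-q) * ENNReal.ofReal (Real.Gamma q) ∂μ :=
          (lintegral_mul_const _ (by fun_prop)).symm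
      _ ≤ ∫⁻ x, (∫⁻ t : ℝ in Set.Ioi 0,
            ENNReal.ofReal (t ^ (q - 1) * Real.exp (-(‖x‖ ^ 2 * t)))) ∂μ :=
          lintegral_mono fun x => ofReal_rpow_neg_le_lintegral hq (by positivity)
      _ = ∫⁻ t : ℝ in Set.Ioi 0, ∫⁻ x,
            ENNReal.ofReal (t ^ (q - 1) * Real.exp (-(‖x‖ ^ 2 * t))) ∂μ :=
          lintegral_lintegral_swap (by unfold Function.uncurry; fun_prop)
      _ = _ := by
          refine setLIntegral_congr_fun measurableSet_Ioi fun t (ht : 0 < t) => ?_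
          have := lintegral_exp_mul_norm_sq_stdGaussian n (a := -t) (by linarith)
          rw [show 1 - 2 * -t = 1 + 2 * t by ring] at this
          rw [ENNReal.ofReal_mul (by positivity), ← this, ← lintegral_const_mul _ (by fun_prop)]
          refine lintegral_congr fun x => ?_
          rw [← ENNReal.ofReal_mul (by positivity)]
          congr 3
          ring
  -- This Beta-type integral is evaluated by writing `(1 + 2t) ^ (-n/2)` as a second Gamma integral
  -- and integrating over `t` first.
  have h2 : (∫⁻ t in Set.Ioi (0 : ℝ),
        ENNReal.ofReal (t ^ (q - 1) * (1 + 2 * t) ^ (-(n / 2) : ℝ))) *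
        ENNReal.ofReal (Real.Gamma (n / 2)) =
      ENNReal.ofReal (Real.Gamma q * (2 ^ (-q) * Real.Gamma (n / 2 - q))) := by
    calc _ = ∫⁻ t in Set.Ioi (0 : ℝ), ∫⁻ s in Set.Ioi (0 : ℝ),
            ENNReal.ofReal (t ^ (q - 1) * (s ^ ((n : ℝ) / 2 - 1) *
              Real.exp (-((1 + 2 * t) * s)))) := by
          rw [← lintegral_mul_const _ (by fun_prop)]
          refine setLIntegral_congr_fun measurableSet_Ioi fun t (ht : 0 < t) => ?_
          rw [ENNReal.ofReal_mul (by positivity), mul_assoc, ← ENNReal.ofReal_mul (by positivity),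
            mul_comm (_ ^ (-(n / 2) : ℝ)), ← lintegral_rpow_mul_exp_neg hn (by positivity),
            ← lintegral_const_mul _ (by fun_prop)]
          refine lintegral_congr fun s => ?_
          rw [← ENNReal.ofReal_mul (by positivity)]
      _ = ∫⁻ s in Set.Ioi (0 : ℝ), ∫⁻ t in Set.Ioi (0 : ℝ),
            ENNReal.ofReal (t ^ (q - 1) * (s ^ ((n : ℝ) / 2 - 1) *
              Real.exp (-((1 + 2 * t) * s)))) :=
          lintegral_lintegral_swap (by unfold Function.uncurry; fun_prop)
      _ = ∫⁻ s in Set.Ioi (0 : ℝ), ENNReal.ofReal (Real.Gamma q * 2 ^ (-q)) *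
            ENNReal.ofReal (s ^ ((n : ℝ) / 2 - q - 1) * Real.exp (-(1 * s))) := by
          refine setLIntegral_congr_fun measurableSet_Ioi fun s (hs : 0 < s) => ?_
          have h3 := lintegral_rpow_mul_exp_neg (c := 2 * s) hq (by positivity)
          have h4 : ∀ t ∈ Set.Ioi (0 : ℝ), ENNReal.ofReal (t ^ (q - 1) * (s ^ ((n : ℝ) / 2 - 1) *
              Real.exp (-((1 + 2 * t) * s)))) =
              ENNReal.ofReal (s ^ ((n : ℝ) / 2 - 1) * Real.exp (-s)) *
              ENNReal.ofReal (t ^ (q - 1) * Real.exp (-(2 * s * t))) := by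
            intro t ht
            rw [← ENNReal.ofReal_mul (by positivity),
              show -((1 + 2 * t) * s) = -s + -(2 * s * t) by ring, Real.exp_add]
            congr 1
            ring
          rw [setLIntegral_congr_fun measurableSet_Ioi h4, lintegral_const_mul _ (by fun_prop), h3,
            ← ENNReal.ofReal_mul (by positivity), ← ENNReal.ofReal_mul (by positivity),
            show (n : ℝ) / 2 - q - 1 = ((n : ℝ) / 2 - 1) + -q by ring, Real.rpow_add hs,
            Real.mul_rpow (by norm_num) hs.le, one_mul]
          congr 1
          ring
      _ = _ := by
          rw [lintegral_const_mul _ (by fun_prop),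
            lintegral_rpow_mul_exp_neg (by linarith) one_pos, ← ENNReal.ofReal_mul (by positivity)]
          simp only [Real.one_rpow, mul_one]
          congr 1
          ring
  have h3 : (∫⁻ x, ENNReal.ofReal (‖x‖ ^ 2) ^ (-q) ∂μ) *
      (ENNReal.ofReal (Real.Gamma q) * ENNReal.ofReal (Real.Gamma (n / 2))) ≤
      ENNReal.ofReal (invChiSqMoment n q) *
      (ENNReal.ofReal (Real.Gamma q) * ENNReal.ofReal (Real.Gamma (n / 2))) := by
    have hG : 0 ≤ invChiSqMoment n q := by
      have := Real.Gamma_pos_of_pos (show 0 < (n : ℝ) / 2 - q by linarith)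
      unfold invChiSqMoment
      positivity
    rw [← mul_assoc]
    refine (mul_le_mul_left h1 _).trans (h2.le.trans ?_)
    rw [← ENNReal.ofReal_mul hGq.le, ← ENNReal.ofReal_mul hG]
    refine (congrArg _ ?_).le
    unfold invChiSqMoment
    field_simp
  rwa [ENNReal.mul_le_mul_iff_left (by positivity)
    (ENNReal.mul_ne_top ENNReal.ofReal_ne_top ENNReal.ofReal_ne_top)] at h3

theorem invChiSqMoment_one {p : ℕ} (hp : 2 ≤ p) :
    invChiSqMoment (p + 1) 1 = 1 / ((p : ℝ) - 1) := by
  have hp' : (2 : ℝ) ≤ p := by exact_mod_cast hp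
  have h := Real.Gamma_add_one (s := ((p : ℝ) - 1) / 2) (by linarith)
  have hpos := Real.Gamma_pos_of_pos (s := ((p : ℝ) - 1) / 2) (by linarith)
  unfold invChiSqMoment
  push_cast
  rw [show ((p : ℝ) + 1) / 2 - 1 = ((p : ℝ) - 1) / 2 by ring,
    show ((p : ℝ) + 1) / 2 = ((p : ℝ) - 1) / 2 + 1 by ring, h, Real.rpow_neg_one]
  have : (p : ℝ) - 1 ≠ 0 := by linarith
  field_simp

/-- This drives the induction `p → p + 2` below, with `x = p + 1`. In terms of `y = 2 / x ≤ 2 / 5`,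
the logarithm is at most `1 + y²/4 + y³/4 ≤ 1.056`, while `log 3 > 1.06`. -/
theorem one_add_two_div_rpow_le {x : ℝ} (hx : 5 ≤ x) :
    (1 + 2 / x) ^ ((x + 1) / 2) ≤ 3 := by
  have hy0 : 0 < 2 / x := by positivity
  have hy1 : 2 / x ≤ 2 / 5 := by gcongr
  set y := 2 / x with hy
  have hx' : (x + 1) / 2 = 1 / y + 1 / 2 := by rw [hy]; field_simp
  have hlog : Real.log (1 + y) ≤ y - y ^ 2 / 2 + y ^ 3 / 2 := by
    have hz : 0 ≤ y - y ^ 2 / 2 + y ^ 3 / 2 := by nlinarith [pow_pos hy0 3]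
    rw [Real.log_le_iff_le_exp (by positivity)]
    refine le_trans ?_ (Real.quadratic_le_exp_of_nonneg hz)
    -- This is exactly the excess of `1 + z + z²/2` over `1 + y`, with `z` the cubic that bounds the
    -- logarithm.
    have h : 0 ≤ y ^ 4 * (5 / 8 - y / 4 + y ^ 2 / 8) := by
      have : 0 ≤ 5 / 8 - y / 4 + y ^ 2 / 8 := by nlinarith
      positivity
    linarith
  have hexp : (1.06 : ℝ) ≤ Real.log 3 := by
    rw [Real.le_log_iff_exp_le (by norm_num)]
    have h := Real.exp_bound' (x := 0.06) (by norm_num) (by norm_num) (n := 2) (by norm_num)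
    rw [show (1.06 : ℝ) = 1 + 0.06 by norm_num, Real.exp_add]
    have h1 := Real.exp_one_lt_d9
    have h2 : Real.exp 0.06 ≤ 1.07 := h.trans (by norm_num [Finset.sum_range_succ, Nat.factorial])
    nlinarith [Real.exp_pos 0.06, Real.exp_pos 1]
  rw [← Real.log_le_log_iff (by positivity) (by norm_num), Real.log_rpow (by positivity), hx']
  refine le_trans ?_ hexp
  calc (1 / y + 1 / 2) * Real.log (1 + y)
      ≤ (1 / y + 1 / 2) * (y - y ^ 2 / 2 + y ^ 3 / 2) := by gcongr
    _ = 1 + y ^ 2 / 4 + y ^ 3 / 4 := by field_simp; ring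
    _ ≤ 1 + (2 / 5) ^ 2 / 4 + (2 / 5) ^ 3 / 4 := by gcongr
    _ ≤ _ := by norm_num

/-- Induction in steps of two from `p = 4` and `p = 5`: the Gamma function gains the factor `(p + 1)
/ 2`, and the left side gains at most `3 (p + 1) / 6`. -/
theorem sqrt_pi_mul_rpow_le_Gamma {p : ℕ} (hp : 4 ≤ p) :
    √Real.pi * (((p : ℝ) + 1) / 6) ^ ((p : ℝ) / 2) ≤ Real.Gamma (((p : ℝ) + 1) / 2) := by
  have hstep : ∀ p : ℕ, 4 ≤ p →
      √Real.pi * (((p : ℝ) + 1) / 6) ^ ((p : ℝ) / 2) ≤ Real.Gamma (((p : ℝ) + 1) / 2) →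
      √Real.pi * ((((p + 2 : ℕ) : ℝ) + 1) / 6) ^ (((p + 2 : ℕ) : ℝ) / 2) ≤
        Real.Gamma ((((p + 2 : ℕ) : ℝ) + 1) / 2) := by
    intro p hp ih
    have hp' : (4 : ℝ) ≤ p := by exact_mod_cast hp
    set x : ℝ := (p : ℝ) + 1 with hx
    have hx0 : 0 < x := by linarith
    have h3 := one_add_two_div_rpow_le (x := x) (by linarith)
    rw [show ((p + 2 : ℕ) : ℝ) / 2 = p / 2 + 1 by push_cast; ring,
      show (((p + 2 : ℕ) : ℝ) + 1) / 2 = x / 2 + 1 by push_cast; rw [hx]; ring,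
      show (((p + 2 : ℕ) : ℝ) + 1) / 6 = (x / 6) * (1 + 2 / x) by
        push_cast; rw [hx]; field_simp; ring,
      Real.Gamma_add_one (by positivity), Real.mul_rpow (by positivity) (by positivity),
      Real.rpow_add_one (by positivity)]
    rw [show (x + 1) / 2 = (p : ℝ) / 2 + 1 by rw [hx]; ring] at h3
    calc √Real.pi * ((x / 6) ^ ((p : ℝ) / 2) * (x / 6) * (1 + 2 / x) ^ ((p : ℝ) / 2 + 1))
        = (x / 6 * (1 + 2 / x) ^ ((p : ℝ) / 2 + 1)) * (√Real.pi * (x / 6) ^ ((p : ℝ) / 2)) := by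
          ring
      _ ≤ (x / 6 * 3) * Real.Gamma (x / 2) := by gcongr
      _ = _ := by ring
  induction p using Nat.strong_induction_on with
  | _ p ih =>
    rcases lt_or_ge p 6 with h | h
    · interval_cases p
      · have hG := Real.Gamma_add_one (s := 1 / 2) (by norm_num)
        have hG' := Real.Gamma_add_one (s := 3 / 2) (by norm_num)
        norm_num [Real.Gamma_one_half_eq] at hG hG' ⊢
        rw [hG', hG]
        have := Real.sqrt_pos.2 Real.pi_pos
        nlinarith
      · have hpi := Real.pi_lt_d2
        have h1 : √Real.pi ≤ 2 := Real.sqrt_le_iff.2 ⟨by norm_num, by linarith⟩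
        have hG : Real.Gamma 3 = 2 := by
          rw [show (3 : ℝ) = ((2 : ℕ) : ℝ) + 1 by norm_num, Real.Gamma_nat_eq_factorial]
          norm_num [Nat.factorial]
        norm_num [hG]
        exact h1
    · obtain ⟨m, rfl⟩ : ∃ m, p = m + 2 := ⟨p - 2, by omega⟩
      exact hstep m (by omega) (ih m (by omega) (by omega))

/-- Source of the constant 3 in the probability bound. With `p + 1` degrees of freedom and order `p
/ 2`, the numerator is `Γ(1/2) = √π`. -/
theorem invChiSqMoment_half_le {p : ℕ} (hp : 4 ≤ p) :
    invChiSqMoment (p + 1) ((p : ℝ) / 2) ≤ (3 / ((p : ℝ) + 1)) ^ ((p : ℝ) / 2) := by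
  have h := sqrt_pi_mul_rpow_le_Gamma hp
  have hp' : (0 : ℝ) < (p : ℝ) + 1 := by positivity
  have hG : 0 < Real.Gamma (((p : ℝ) + 1) / 2) := Real.Gamma_pos_of_pos (by positivity)
  unfold invChiSqMoment
  push_cast
  rw [show ((p : ℝ) + 1) / 2 - p / 2 = 1 / 2 by ring, Real.Gamma_one_half_eq, div_le_iff₀ hG,
    Real.rpow_neg (by norm_num)]
  calc _ = (3 / ((p : ℝ) + 1)) ^ ((p : ℝ) / 2) *
        (√Real.pi * (((p : ℝ) + 1) / 6) ^ ((p : ℝ) / 2)) := by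
        rw [mul_left_comm, ← Real.mul_rpow (by positivity) (by positivity), mul_comm,
          ← Real.inv_rpow (by norm_num)]
        congr 2
        field_simp
        norm_num
    _ ≤ _ := by gcongr

/-! ### Residuals of orthogonal projections onto spans of finite families -/

section Residual

variable {V : Type*} [NormedAddCommGroup V] [InnerProductSpace ℝ V] {ι : Type*} [Finite ι]

/-- The component of `z` orthogonal to the span of the finite family `Y`. -/
noncomputable def residual (Y : ι → V) (z : V) : V :=
  haveI : FiniteDimensional ℝ (Submodule.span ℝ (Set.range Y)) :=
    FiniteDimensional.span_of_finite ℝ (Set.finite_range Y)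
  z - (Submodule.span ℝ (Set.range Y)).starProjection z

theorem residual_eq (Y : ι → V) (z : V)
    [(Submodule.span ℝ (Set.range Y)).HasOrthogonalProjection] :
    residual Y z = z - (Submodule.span ℝ (Set.range Y)).starProjection z := rfl

theorem sub_residual_mem (Y : ι → V) (z : V) :
    z - residual Y z ∈ Submodule.span ℝ (Set.range Y) := by
  have : FiniteDimensional ℝ (Submodule.span ℝ (Set.range Y)) :=
    FiniteDimensional.span_of_finite ℝ (Set.finite_range Y)
  rw [residual_eq, sub_sub_cancel]
  exact Submodule.starProjection_apply_mem _ z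

theorem inner_residual_eq_zero (Y : ι → V) (z : V) {y : V}
    (hy : y ∈ Submodule.span ℝ (Set.range Y)) : inner ℝ y (residual Y z) = 0 := by
  have : FiniteDimensional ℝ (Submodule.span ℝ (Set.range Y)) :=
    FiniteDimensional.span_of_finite ℝ (Set.finite_range Y)
  rw [residual_eq, real_inner_comm]
  exact Submodule.starProjection_inner_eq_zero z y hy

theorem norm_residual_le (Y : ι → V) (z : V) {y : V}
    (hy : y ∈ Submodule.span ℝ (Set.range Y)) : ‖residual Y z‖ ≤ ‖z - y‖ := by
  have h1 : z - y = residual Y z + (z - residual Y z - y) := by abel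
  have h2 : inner ℝ (residual Y z) (z - residual Y z - y) = 0 := by
    rw [real_inner_comm]
    exact inner_residual_eq_zero Y z (Submodule.sub_mem _ (sub_residual_mem Y z) hy)
  have h3 := norm_add_sq_eq_norm_sq_add_norm_sq_of_inner_eq_zero _ _ h2
  rw [← h1] at h3
  nlinarith [norm_nonneg (residual Y z), norm_nonneg (z - y),
    mul_self_nonneg ‖z - residual Y z - y‖]

theorem inner_residual_self (Y : ι → V) (z : V) :
    inner ℝ z (residual Y z) = ‖residual Y z‖ ^ 2 := by
  have h := inner_residual_eq_zero Y z (sub_residual_mem Y z)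
  rw [inner_sub_left, real_inner_self_eq_norm_sq] at h
  linarith

theorem residual_add (Y : ι → V) (z : V) {y : V}
    (hy : y ∈ Submodule.span ℝ (Set.range Y)) : residual Y (z + y) = residual Y z := by
  have : FiniteDimensional ℝ (Submodule.span ℝ (Set.range Y)) :=
    FiniteDimensional.span_of_finite ℝ (Set.finite_range Y)
  rw [residual_eq, residual_eq, map_add, Submodule.starProjection_eq_self_iff.2 hy]
  abel

theorem residual_smul (Y : ι → V) (c : ℝ) (z : V) :
    residual Y (c • z) = c • residual Y z := by
  have : FiniteDimensional ℝ (Submodule.span ℝ (Set.range Y)) :=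
    FiniteDimensional.span_of_finite ℝ (Set.finite_range Y)
  rw [residual_eq, residual_eq, map_smul, smul_sub]

/-- The residual is not continuous in `Y` where the rank drops. Rational coefficients write its
sublevel sets as countable unions, which gives measurability. -/
theorem norm_residual_lt_iff [Fintype ι] (Y : ι → V) (z : V) (a : ℝ) :
    ‖residual Y z‖ < a ↔ ∃ c : ι → ℚ, ‖z - ∑ i, (c i : ℝ) • Y i‖ < a := by
  constructor
  · intro h
    obtain ⟨c, hc⟩ := (Submodule.mem_span_range_iff_exists_fun ℝ).1 (sub_residual_mem Y z)
    have hcont : Continuous fun c : ι → ℝ => ‖z - ∑ i, c i • Y i‖ := by fun_prop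
    have hopen : IsOpen {c : ι → ℝ | ‖z - ∑ i, c i • Y i‖ < a} :=
      isOpen_lt hcont continuous_const
    have hdense : DenseRange fun (c : ι → ℚ) (i : ι) => (c i : ℝ) :=
      DenseRange.piMap fun _ => Rat.denseRange_cast
    obtain ⟨c', hc'⟩ := hdense.exists_mem_open hopen ⟨c, by
      rw [Set.mem_ofPred_eq, hc, sub_sub_cancel]; exact h⟩
    exact ⟨c', hc'⟩
  · rintro ⟨c, hc⟩
    refine (norm_residual_le Y z ?_).trans_lt hc
    exact Submodule.sum_mem _ fun i _ =>
      Submodule.smul_mem _ _ (Submodule.subset_span (Set.mem_range_self i))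

theorem measurable_norm_residual {S : Type*} [MeasurableSpace S] {Z : S → V} {Y : ι → S → V}
    (hZ : StronglyMeasurable Z) (hY : ∀ i, StronglyMeasurable (Y i)) :
    Measurable fun w => ‖residual (fun i => Y i w) (Z w)‖ := by
  have := Fintype.ofFinite ι
  refine measurable_of_Iio fun a => ?_
  have : (fun w => ‖residual (fun i => Y i w) (Z w)‖) ⁻¹' Set.Iio a =
      ⋃ c : ι → ℚ, {w | ‖Z w - ∑ i, (c i : ℝ) • Y i w‖ < a} := by
    ext w
    simp [norm_residual_lt_iff]
  rw [this]
  refine MeasurableSet.iUnion fun c => ?_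
  have hm : StronglyMeasurable fun w => Z w - ∑ i, (c i : ℝ) • Y i w :=
    hZ.sub (Finset.stronglyMeasurable_fun_sum _ fun i _ => (hY i).const_smul _)
  exact measurableSet_lt hm.norm.measurable measurable_const

theorem aemeasurable_norm_residual {S : Type*} [MeasurableSpace S] {P : Measure S} {Z : S → V}
    {Y : ι → S → V} (hZ : AEStronglyMeasurable Z P) (hY : ∀ i, AEStronglyMeasurable (Y i) P) :
    AEMeasurable (fun w => ‖residual (fun i => Y i w) (Z w)‖) P := by
  refine ⟨_, measurable_norm_residual hZ.stronglyMeasurable_mk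
    fun i => (hY i).stronglyMeasurable_mk, ?_⟩
  filter_upwards [hZ.ae_eq_mk, ae_all_iff.2 fun i => (hY i).ae_eq_mk] with w h1 h2
  simp only [← h1, ← h2]

end Residual

/-! ### Projections of standard Gaussian vectors -/

theorem stdGaussian_map_adjoint {V V' : Type*}
    [NormedAddCommGroup V] [InnerProductSpace ℝ V] [FiniteDimensional ℝ V]
    [MeasurableSpace V] [BorelSpace V]
    [NormedAddCommGroup V'] [InnerProductSpace ℝ V'] [FiniteDimensional ℝ V']
    [MeasurableSpace V'] [BorelSpace V'] (J : V' →ₗᵢ[ℝ] V) :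
    (stdGaussian V).map (ContinuousLinearMap.adjoint J.toContinuousLinearMap) =
      stdGaussian V' := by
  have : IsProbabilityMeasure
      ((stdGaussian V).map (ContinuousLinearMap.adjoint J.toContinuousLinearMap)) :=
    Measure.isProbabilityMeasure_map (by fun_prop)
  apply Measure.ext_of_charFun
  ext t
  rw [charFun_stdGaussian, charFun_apply, integral_map (by fun_prop) (by fun_prop)]
  simp_rw [ContinuousLinearMap.adjoint_inner_left]
  rw [← charFun_apply, charFun_stdGaussian]
  simp

theorem exists_linearIsometry_orthogonal {V : Type*} [NormedAddCommGroup V]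
    [InnerProductSpace ℝ V] [FiniteDimensional ℝ V] (U : Submodule ℝ V) {n : ℕ}
    (hn : n + Module.finrank ℝ U ≤ Module.finrank ℝ V) :
    ∃ J : EuclideanSpace ℝ (Fin n) →ₗᵢ[ℝ] V, ∀ t, J t ∈ Uᗮ := by
  have hU : n ≤ Module.finrank ℝ Uᗮ := by
    have := U.finrank_add_finrank_orthogonal
    omega
  have hb := (stdOrthonormalBasis ℝ Uᗮ).orthonormal.comp (Fin.castLE hU) (Fin.castLE_injective hU)
  let c := EuclideanSpace.basisFun (Fin n) ℝ
  let f : EuclideanSpace ℝ (Fin n) →ₗ[ℝ] Uᗮ :=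
    c.toBasis.constr ℝ (stdOrthonormalBasis ℝ Uᗮ ∘ Fin.castLE hU)
  have hf : Orthonormal ℝ (f ∘ c.toBasis) := by
    have : f ∘ c.toBasis = stdOrthonormalBasis ℝ Uᗮ ∘ Fin.castLE hU := by
      ext i
      simp [f]
    rwa [this]
  have hc : Orthonormal ℝ c.toBasis := by simp [c]
  exact ⟨Uᗮ.subtypeₗᵢ.comp (f.isometryOfOrthonormal hc hf), fun t => (f t).2⟩

/-- The orthogonal complement of the span has dimension at least `n`, and more when the `Y i` are
dependent. Projecting onto an `n`-dimensional part of it only shortens the residual and leaves a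
standard Gaussian vector of `ℝ^n`. -/
theorem lintegral_norm_residual_sq_rpow_neg_le {ι : Type*} [Finite ι] {l n : ℕ}
    (Y : ι → EuclideanSpace ℝ (Fin l)) (hn : n + Nat.card ι ≤ l) {q : ℝ} (hq : 0 < q)
    (hqn : q < n / 2) :
    ∫⁻ r, ENNReal.ofReal (‖residual Y r‖ ^ 2) ^ (-q)
        ∂(stdGaussian (EuclideanSpace ℝ (Fin l))) ≤ ENNReal.ofReal (invChiSqMoment n q) := by
  have := Fintype.ofFinite ι
  obtain ⟨J, hJ⟩ := exists_linearIsometry_orthogonal (n := n) (Submodule.span ℝ (Set.range Y)) (by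
    have h := finrank_range_le_card (R := ℝ) Y
    rw [Set.finrank] at h
    rw [Nat.card_eq_fintype_card] at hn
    rw [finrank_euclideanSpace_fin]
    omega)
  have hstd := lintegral_norm_sq_rpow_neg_stdGaussian_le n hq hqn
  set L := ContinuousLinearMap.adjoint J.toContinuousLinearMap
  have hL : ∀ r, ‖L r‖ ≤ ‖residual Y r‖ := by
    intro r
    have h1 : L r = L (residual Y r) := by
      refine ext_inner_right ℝ fun t => ?_
      rw [ContinuousLinearMap.adjoint_inner_left, ContinuousLinearMap.adjoint_inner_left,
        ← sub_eq_zero, ← inner_sub_left]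
      exact hJ t _ (sub_residual_mem Y r)
    have h2 : ‖L‖ ≤ 1 := by
      rw [LinearIsometryEquiv.norm_map]
      exact J.norm_toContinuousLinearMap_le
    calc ‖L r‖ = ‖L (residual Y r)‖ := by rw [h1]
      _ ≤ 1 * ‖residual Y r‖ := L.le_of_opNorm_le h2 _
      _ = _ := one_mul _
  have hmap := stdGaussian_map_adjoint J
  rw [← hmap, lintegral_map (by fun_prop) (by fun_prop)] at hstd
  refine le_trans (lintegral_mono fun r => ?_) hstd
  simp only [ENNReal.rpow_neg, ENNReal.inv_le_inv]
  gcongr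
  exact hL r

/-! ### Hilbert–Schmidt norms -/

section Deterministic

variable {H₁ H₂ : Type*} [NormedAddCommGroup H₁] [InnerProductSpace ℝ H₁]
  [NormedAddCommGroup H₂] [InnerProductSpace ℝ H₂]

theorem enorm_sq_eq_ofReal {V : Type*} [NormedAddCommGroup V] (x : V) :
    ‖x‖ₑ ^ 2 = ENNReal.ofReal (‖x‖ ^ 2) := by
  rw [← ofReal_norm, ENNReal.ofReal_pow (norm_nonneg x)]

theorem tsum_enorm_inner_sq {ι : Type*} (b : HilbertBasis ι ℝ H₁) (x : H₁) :
    ∑' i, ‖inner ℝ (b i) x‖ₑ ^ 2 = ‖x‖ₑ ^ 2 := by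
  have h := b.hasSum_inner_mul_inner x x
  simp_rw [real_inner_comm x, ← sq, real_inner_self_eq_norm_sq, ← real_inner_comm x] at h
  simp_rw [enorm_sq_eq_ofReal, Real.norm_eq_abs, sq_abs]
  have h' : HasSum (fun i => inner ℝ (b i) x ^ 2) (‖x‖ ^ 2) := by
    simpa only [real_inner_comm] using h
  rw [← h'.tsum_eq, ENNReal.ofReal_tsum_of_nonneg (fun _ => sq_nonneg _) h'.summable]

/-- Both sides are the sum of the squared matrix entries, by rows or by columns. Working in `ℝ≥0∞`
permits the exchange without summability. -/
theorem tsum_enorm_sq_adjoint [CompleteSpace H₁] [CompleteSpace H₂] {ι κ : Type*}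
    (b : HilbertBasis ι ℝ H₁) (f : HilbertBasis κ ℝ H₂) (A : H₁ →L[ℝ] H₂) :
    ∑' i, ‖A (b i)‖ₑ ^ 2 = ∑' m, ‖ContinuousLinearMap.adjoint A (f m)‖ₑ ^ 2 := by
  simp_rw [← tsum_enorm_inner_sq f (A _), ← tsum_enorm_inner_sq b (ContinuousLinearMap.adjoint A _)]
  rw [ENNReal.tsum_comm]
  simp_rw [ContinuousLinearMap.adjoint_inner_right, real_inner_comm]

/-- The Hilbert–Schmidt norm may be computed in any complete orthonormal basis, hence in any
orthonormal family outside of whose span the operator vanishes. -/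
theorem tsum_enorm_sq_eq_of_orthonormal [CompleteSpace H₁] [CompleteSpace H₂] {ι : Type*}
    (e : HilbertBasis ι ℝ H₁) (A : H₁ →L[ℝ] H₂)
    {v : ℕ → H₁} (hv : Orthonormal ℝ v) (hA : ∀ f, (∀ j, inner ℝ (v j) f = 0) → A f = 0) :
    ∑' i, ‖A (e i)‖ₑ ^ 2 = ∑' j, ‖A (v j)‖ₑ ^ 2 := by
  -- The family is completed to a basis `b`, compared with `e` through a basis of `H₂`. The added
  -- vectors are orthogonal to every `v j`, so `A` kills them.
  obtain ⟨w, b, hw, hb⟩ := hv.toSubtypeRange.exists_hilbertBasis_extension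
  obtain ⟨w', f, -⟩ := exists_hilbertBasis ℝ H₂
  rw [tsum_enorm_sq_adjoint e f, ← tsum_enorm_sq_adjoint b f, hb]
  let g : ℕ → w := fun j => ⟨v j, hw (Set.mem_range_self j)⟩
  have hg : Function.Injective g := fun i j hij =>
    hv.linearIndependent.injective (congrArg Subtype.val hij)
  refine (hg.tsum_eq (f := fun x : w => ‖A (x : H₁)‖ₑ ^ 2) ?_).symm
  intro x hx
  by_contra hne
  refine hx ?_
  have : A (x : H₁) = 0 := hA _ fun j => by
    have h := b.orthonormal.2 (i := g j) (j := x) fun h => hne ⟨j, h⟩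
    rwa [hb] at h
  simp [this]

/-! ### Singular value decompositions. -/

theorem IsSVD.apply_right {F : H₁ →L[ℝ] H₂} {σ : ℕ → ℝ} {v : ℕ → H₁} {u : ℕ → H₂}
    (h : IsSVD F σ v u) (j : ℕ) : F (v j) = σ j • u j := by
  refine (h.hasSum (v j)).unique ?_
  have h2 := hasSum_ite_eq j (σ j • u j)
  convert h2 using 2 with i
  rw [orthonormal_iff_ite.1 h.orthonormal_right i j]
  split_ifs with hij
  · rw [hij, mul_one]
  · simp

theorem IsSVD.hasSum_norm_sq {F : H₁ →L[ℝ] H₂} {σ : ℕ → ℝ} {v : ℕ → H₁} {u : ℕ → H₂}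
    (h : IsSVD F σ v u) (f : H₁) :
    HasSum (fun j => σ j ^ 2 * inner ℝ (v j) f ^ 2) (‖F f‖ ^ 2) := by
  have h1 := ((h.hasSum f).norm).pow 2
  refine h1.congr fun s => ?_
  rw [← real_inner_self_eq_norm_sq, h.orthonormal_left.inner_sum]
  refine Finset.sum_congr rfl fun i _ => ?_
  simp
  ring

theorem IsSVD.apply_eq_zero {F : H₁ →L[ℝ] H₂} {σ : ℕ → ℝ} {v : ℕ → H₁} {u : ℕ → H₂}
    (h : IsSVD F σ v u) {f : H₁} (hf : ∀ j, inner ℝ (v j) f = 0) : F f = 0 := by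
  refine (h.hasSum f).unique ?_
  simp [hf, hasSum_zero]

theorem IsSVD.norm_apply_right {F : H₁ →L[ℝ] H₂} {σ : ℕ → ℝ} {v : ℕ → H₁} {u : ℕ → H₂}
    (h : IsSVD F σ v u) (j : ℕ) : ‖F (v j)‖ = σ j := by
  rw [h.apply_right, norm_smul, h.orthonormal_left.1 j, mul_one, Real.norm_eq_abs,
    abs_of_nonneg (h.nonneg j)]

theorem IsSVD.summable_sq [CompleteSpace H₁] [CompleteSpace H₂] {F : H₁ →L[ℝ] H₂}
    {σ : ℕ → ℝ} {v : ℕ → H₁} {u : ℕ → H₂}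
    (h : IsSVD F σ v u) {e : HilbertBasis ℕ ℝ H₁} (hF : IsHilbertSchmidt e F) :
    Summable fun j => σ j ^ 2 := by
  have h1 := tsum_enorm_sq_eq_of_orthonormal e F h.orthonormal_right fun f => h.apply_eq_zero
  simp_rw [enorm_sq_eq_ofReal, h.norm_apply_right] at h1
  have h2 : ∑' j, ENNReal.ofReal (σ j ^ 2) ≠ ∞ := by
    rw [← h1, ← ENNReal.ofReal_tsum_of_nonneg (fun _ => sq_nonneg _) hF]
    exact ENNReal.ofReal_ne_top
  have h3 := ENNReal.summable_toReal h2
  simpa only [ENNReal.toReal_ofReal (sq_nonneg _)] using h3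

/-! ### The error operator and its deterministic bound. -/

section Error

variable {ℓ : ℕ} (F : H₁ →L[ℝ] H₂) (om : Fin ℓ → H₁)

/-- The operator `F - P_Y F`. -/
noncomputable def errorOp : H₁ →L[ℝ] H₂ := F - (projCol fun j => F (om j)) ∘L F

theorem errorOp_apply (f : H₁) : errorOp F om f = residual (fun j => F (om j)) (F f) := by
  simp [errorOp, residual, projCol, colSpace]

theorem svdError_eq (e : HilbertBasis ℕ ℝ H₁) :
    svdError e F om = √(∑' j, ‖errorOp F om (e j)‖ ^ 2) := rfl

/-- `1 - P_Y` annihilates every `F (om l)`, so `f` may be corrected by any combination of the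
columns. The freedom in `c` is what the deterministic bound exploits. -/
theorem norm_errorOp_apply_le (f : H₁) (c : Fin ℓ → ℝ) :
    ‖errorOp F om f‖ ≤ ‖F (f - ∑ l, c l • om l)‖ := by
  rw [errorOp_apply, map_sub]
  refine norm_residual_le _ _ ?_
  rw [map_sum]
  refine Submodule.sum_mem _ fun l _ => ?_
  rw [map_smul]
  exact Submodule.smul_mem _ _ (Submodule.subset_span ⟨l, rfl⟩)

theorem norm_errorOp_apply_le_norm (f : H₁) : ‖errorOp F om f‖ ≤ ‖F f‖ := by
  simpa using norm_errorOp_apply_le F om f 0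

variable {F} in
theorem summable_errorOp {e : HilbertBasis ℕ ℝ H₁} (hF : IsHilbertSchmidt e F) :
    Summable fun j => ‖errorOp F om (e j)‖ ^ 2 :=
  Summable.of_nonneg_of_le (fun _ => sq_nonneg _)
    (fun j => by gcongr; exact norm_errorOp_apply_le_norm F om _) hF

variable {F} in
theorem svdError_le_hsNorm {e : HilbertBasis ℕ ℝ H₁} (hF : IsHilbertSchmidt e F) :
    svdError e F om ≤ hsNorm e F :=
  Real.sqrt_le_sqrt <| (summable_errorOp om hF).tsum_le_tsum
    (fun j => by gcongr; exact norm_errorOp_apply_le_norm F om _) hF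

variable {F} in
theorem svdError_sq_eq [CompleteSpace H₁] [CompleteSpace H₂] {σ : ℕ → ℝ} {v : ℕ → H₁} {u : ℕ → H₂}
    (h : IsSVD F σ v u) {e : HilbertBasis ℕ ℝ H₁} (hF : IsHilbertSchmidt e F) :
    HasSum (fun j => ‖errorOp F om (v j)‖ ^ 2) (svdError e F om ^ 2) := by
  have h1 := tsum_enorm_sq_eq_of_orthonormal e (errorOp F om) h.orthonormal_right fun f hf => by
    rw [← norm_le_zero_iff]
    exact (norm_errorOp_apply_le_norm F om f).trans (by rw [h.apply_eq_zero hf, norm_zero])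
  have hs : Summable fun j => ‖errorOp F om (v j)‖ ^ 2 :=
    Summable.of_nonneg_of_le (fun _ => sq_nonneg _) (fun j => by
      rw [← h.norm_apply_right j]
      gcongr
      exact norm_errorOp_apply_le_norm F om _) (h.summable_sq hF)
  simp_rw [enorm_sq_eq_ofReal] at h1
  rw [← ENNReal.ofReal_tsum_of_nonneg (fun _ => sq_nonneg _) (summable_errorOp om hF),
    ← ENNReal.ofReal_tsum_of_nonneg (fun _ => sq_nonneg _) hs,
    ENNReal.ofReal_eq_ofReal_iff (tsum_nonneg fun _ => sq_nonneg _)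
      (tsum_nonneg fun _ => sq_nonneg _)] at h1
  rw [svdError_eq, Real.sq_sqrt (tsum_nonneg fun _ => sq_nonneg _), h1]
  exact hs.hasSum

end Error

/-- The vector of coefficients of the columns `om l` along `x`. -/
noncomputable def coeffVec {ℓ : ℕ} (om : Fin ℓ → H₁) (x : H₁) : EuclideanSpace ℝ (Fin ℓ) :=
  WithLp.toLp 2 fun l => inner ℝ x (om l)

/-- The part of the coefficient vector of `v j` that is orthogonal to those of the other
`v i`, `i < k`. -/
noncomputable def coeffResidual {ℓ : ℕ} (om : Fin ℓ → H₁) (v : ℕ → H₁) {k : ℕ} (j : Fin k) :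
    EuclideanSpace ℝ (Fin ℓ) :=
  residual (fun i : {i : Fin k // i ≠ j} => coeffVec om (v i)) (coeffVec om (v j))

/-- The squared Hilbert–Schmidt norm of the part of the sample lying along the tail of the singular
value decomposition. -/
noncomputable def tailEnergy {ℓ : ℕ} (σ : ℕ → ℝ) (v : ℕ → H₁) (k : ℕ) (om : Fin ℓ → H₁) : ℝ :=
  ∑' j, σ (k + j) ^ 2 * ‖coeffVec om (v (k + j))‖ ^ 2

theorem summable_tailEnergy {ℓ : ℕ} {σ : ℕ → ℝ} {v : ℕ → H₁} (hv : Orthonormal ℝ v)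
    (hσ : Summable fun j => σ j ^ 2) (k : ℕ) (om : Fin ℓ → H₁) :
    Summable fun j => σ (k + j) ^ 2 * ‖coeffVec om (v (k + j))‖ ^ 2 := by
  have hσ' : Summable fun j => σ (k + j) ^ 2 := hσ.comp_injective (add_right_injective k)
  refine Summable.of_nonneg_of_le (fun _ => by positivity) (fun j => ?_)
    (hσ'.mul_right (∑ l, ‖om l‖ ^ 2))
  gcongr
  rw [EuclideanSpace.real_norm_sq_eq]
  refine Finset.sum_le_sum fun l _ => ?_
  rw [← sq_abs]
  gcongr
  refine (abs_real_inner_le_norm _ _).trans ?_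
  rw [hv.1, one_mul]

/-- Tail singular vectors cost at most `σ`. Each leading one is corrected by the combination of
columns that cancels all its leading coefficients and has coefficient vector of norm `1 / ‖r‖`. -/
theorem svdError_sq_le [CompleteSpace H₁] [CompleteSpace H₂] {ℓ : ℕ}
    {F : H₁ →L[ℝ] H₂} {σ : ℕ → ℝ} {v : ℕ → H₁} {u : ℕ → H₂}
    (h : IsSVD F σ v u) {e : HilbertBasis ℕ ℝ H₁} (hF : IsHilbertSchmidt e F)
    (om : Fin ℓ → H₁) (k : ℕ) (hpos : ∀ j : Fin k, coeffResidual om v j ≠ 0) :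
    svdError e F om ^ 2 ≤ ∑' j, σ (k + j) ^ 2 +
      (∑ j : Fin k, (‖coeffResidual om v j‖ ^ 2)⁻¹) * tailEnergy σ v k om := by
  have hs := svdError_sq_eq om h hF
  have hσ := h.summable_sq hF
  have hσ' : Summable fun j => σ (k + j) ^ 2 := hσ.comp_injective (add_right_injective k)
  rw [← hs.tsum_eq, ← hs.summable.sum_add_tsum_nat_add k, add_comm, Finset.sum_range,
    Finset.sum_mul]
  refine add_le_add ?_ (Finset.sum_le_sum fun j _ => ?_)
  · have hs' : Summable fun j => ‖errorOp F om (v (j + k))‖ ^ 2 :=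
      (summable_nat_add_iff k).2 hs.summable
    refine hs'.tsum_le_tsum (fun j => ?_) hσ'
    rw [← h.norm_apply_right (k + j), add_comm k j]
    gcongr
    exact norm_errorOp_apply_le_norm F om _
  · set r := coeffResidual om v j with hr
    have hr0 : 0 < ‖r‖ ^ 2 := by
      have := norm_pos_iff.2 (hpos j)
      positivity
    -- the dual vector of the `j`-th coefficient vector
    set m : EuclideanSpace ℝ (Fin ℓ) := (‖r‖ ^ 2)⁻¹ • r with hm
    have hmn : ‖m‖ ^ 2 = (‖r‖ ^ 2)⁻¹ := by
      rw [hm, norm_smul, mul_pow, Real.norm_eq_abs, sq_abs]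
      field_simp
    have hdual : ∀ i : Fin k, inner ℝ (coeffVec om (v i)) m = if i = j then 1 else 0 := by
      intro i
      rw [hm, inner_smul_right]
      split_ifs with hij
      · rw [hij, hr, coeffResidual, inner_residual_self, ← coeffResidual, ← hr]
        exact inv_mul_cancel₀ hr0.ne'
      · have h0 := inner_residual_eq_zero
          (fun i : {i : Fin k // i ≠ j} => coeffVec om (v i)) (coeffVec om (v j))
          (Submodule.subset_span (Set.mem_range_self (⟨i, hij⟩ : {i : Fin k // i ≠ j})))
        rw [hr, coeffResidual, h0, mul_zero]
    have hin : ∀ i, inner ℝ (v i) (v j - ∑ l, m l • om l) =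
        (if i = (j : ℕ) then 1 else 0) - inner ℝ (coeffVec om (v i)) m := by
      intro i
      rw [inner_sub_right, orthonormal_iff_ite.1 h.orthonormal_right, inner_sum]
      congr 1
      rw [coeffVec, PiLp.inner_apply]
      refine Finset.sum_congr rfl fun l _ => ?_
      simp [inner_smul_right]
    have hz : ∀ i, i < k → inner ℝ (v i) (v j - ∑ l, m l • om l) = 0 := by
      intro i hi
      have := hdual ⟨i, hi⟩
      rw [hin, this]
      simp [Fin.ext_iff]
    have hsum := h.hasSum_norm_sq (v j - ∑ l, m l • om l)
    calc ‖errorOp F om (v j)‖ ^ 2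
        ≤ ‖F (v j - ∑ l, m l • om l)‖ ^ 2 := by
          gcongr
          exact norm_errorOp_apply_le F om _ _
      _ = ∑' i, σ (k + i) ^ 2 * inner ℝ (v (k + i)) (v j - ∑ l, m l • om l) ^ 2 := by
          rw [← hsum.tsum_eq, ← hsum.summable.sum_add_tsum_nat_add k, Finset.sum_eq_zero, zero_add]
          · simp_rw [add_comm k]
          · intro i hi
            rw [hz i (Finset.mem_range.1 hi)]
            simp
      _ ≤ ∑' i, (‖r‖ ^ 2)⁻¹ * (σ (k + i) ^ 2 * ‖coeffVec om (v (k + i))‖ ^ 2) := by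
          refine Summable.tsum_le_tsum (fun i => ?_)
            (hsum.summable.comp_injective (add_right_injective k))
            ((summable_tailEnergy h.orthonormal_right hσ k om).mul_left _)
          -- Along a tail direction `v j` itself has no component, so only `-⟨g, m⟩` remains;
          -- Cauchy–Schwarz bounds it, with `‖m‖ ^ 2 = ‖r‖⁻²`.
          rw [hin, if_neg (by omega), zero_sub, neg_sq, ← hmn, mul_left_comm]
          gcongr
          rw [← mul_pow, ← sq_abs, mul_comm ‖m‖]
          gcongr
          exact abs_real_inner_le_norm _ _
      _ = _ := by rw [tsum_mul_left]; rfl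

theorem aestronglyMeasurable_svdError {S : Type*} [MeasurableSpace S] {P : Measure S} {ℓ : ℕ}
    (e : HilbertBasis ℕ ℝ H₁) (F : H₁ →L[ℝ] H₂) {W : Fin ℓ → S → H₁}
    (hW : ∀ j, AEStronglyMeasurable (W j) P) :
    AEStronglyMeasurable (fun w => svdError e F fun j => W j w) P := by
  have h : ∀ j, AEMeasurable (fun w => ‖errorOp F (fun j => W j w) (e j)‖) P := by
    intro j
    simp_rw [errorOp_apply]
    exact aemeasurable_norm_residual aestronglyMeasurable_const
      fun l => F.continuous.comp_aestronglyMeasurable (hW l)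
  have hsum : ∀ w, ∑' j, ‖errorOp F (fun j => W j w) (e j)‖ ^ 2 =
      (∑' j, ENNReal.ofReal (‖errorOp F (fun j => W j w) (e j)‖ ^ 2)).toReal := by
    intro w
    rw [ENNReal.tsum_toReal_eq fun _ => ENNReal.ofReal_ne_top]
    simp
  refine AEMeasurable.aestronglyMeasurable ?_
  simp_rw [svdError_eq, hsum]
  exact Real.continuous_sqrt.measurable.comp_aemeasurable
    (AEMeasurable.tsum fun j => ((h j).pow_const 2).ennreal_ofReal).ennreal_toReal

end Deterministic

/-! ### Independent Gaussian samples in a Hilbert space -/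

section Sample

variable {H : Type*} [NormedAddCommGroup H] [InnerProductSpace ℝ H]
  {S : Type*} [MeasurableSpace S]

/-- The `W l` are independent centered Gaussian vectors with covariance form `B`. -/
structure IsGaussianSample (B : LinearMap.BilinForm ℝ H) (P : Measure S) {ℓ : ℕ}
    (W : Fin ℓ → S → H) : Prop where
  nonneg : ∀ x, 0 ≤ B x x
  symm : ∀ x y, B x y = B y x
  aestronglyMeasurable : ∀ l, AEStronglyMeasurable (W l) P
  law : ∀ h : Fin ℓ → H, P.map (fun w => ∑ l, inner ℝ (h l) (W l w)) =
    gaussianReal 0 (∑ l, B (h l) (h l)).toNNReal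

variable {B : LinearMap.BilinForm ℝ H} {P : Measure S} {ℓ : ℕ}
  {W : Fin ℓ → S → H}

namespace IsGaussianSample

theorem aemeasurable_inner (hW : IsGaussianSample B P W) (x : H) (l : Fin ℓ) :
    AEMeasurable (fun w => inner ℝ x (W l w)) P :=
  (aestronglyMeasurable_const.inner (hW.aestronglyMeasurable l)).aemeasurable

theorem aemeasurable_sum_inner (hW : IsGaussianSample B P W) (h : Fin ℓ → H) :
    AEMeasurable (fun w => ∑ l, inner ℝ (h l) (W l w)) P :=
  Finset.aemeasurable_fun_sum _ fun l _ => hW.aemeasurable_inner (h l) l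

theorem aemeasurable_coeffVec (hW : IsGaussianSample B P W) (x : H) :
    AEMeasurable (fun w => coeffVec (fun l => W l w) x) P :=
  (by fun_prop : Measurable (WithLp.toLp 2 : (Fin ℓ → ℝ) → _)).comp_aemeasurable
    (aemeasurable_pi_lambda _ fun l => hW.aemeasurable_inner x l)

theorem sum_inner_single (om : Fin ℓ → H) (z : H) (l : Fin ℓ) :
    ∑ l', inner ℝ (Pi.single (M := fun _ => H) l z l') (om l') = inner ℝ z (om l) := by
  rw [Finset.sum_eq_single l]
  · simp
  · intro l' _ hl
    simp [Pi.single_eq_of_ne hl]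
  · simp

theorem coeffVec_smul (om : Fin ℓ → H) (c : ℝ) (x : H) :
    coeffVec om (c • x) = c • coeffVec om x := by
  ext l
  simp [coeffVec, inner_smul_left]

theorem coeffVec_sum (om : Fin ℓ → H) {ι : Type*} [Fintype ι] (x : ι → H) :
    coeffVec om (∑ i, x i) = ∑ i, coeffVec om (x i) := by
  ext l
  simp [coeffVec, sum_inner]

theorem inner_coeffVec (om : Fin ℓ → H) (x : H) (t : EuclideanSpace ℝ (Fin ℓ)) :
    inner ℝ (coeffVec om x) t = ∑ l, inner ℝ (t l • x) (om l) := by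
  rw [coeffVec, PiLp.inner_apply]
  simp [inner_smul_left]

theorem variance_sum_inner (hW : IsGaussianSample B P W) (h : Fin ℓ → H) :
    Var[fun w => ∑ l, inner ℝ (h l) (W l w); P] = ∑ l, B (h l) (h l) := by
  have h1 := variance_map (X := id) (μ := P) aemeasurable_id (hW.aemeasurable_sum_inner h)
  rw [hW.law, variance_id_gaussianReal] at h1
  rw [← Function.id_comp (fun w => ∑ l, inner ℝ (h l) (W l w)), ← h1,
    Real.coe_toNNReal _ (Finset.sum_nonneg fun l _ => hW.nonneg _)]

theorem lintegral_norm_coeffVec_sq (hW : IsGaussianSample B P W) (x : H) :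
    ∫⁻ w, ENNReal.ofReal (‖coeffVec (fun l => W l w) x‖ ^ 2) ∂P = ENNReal.ofReal (ℓ * B x x) := by
  have hone : ∀ l, ∫⁻ w, ENNReal.ofReal (inner ℝ x (W l w) ^ 2) ∂P = ENNReal.ofReal (B x x) := by
    intro l
    have hlaw := hW.law (Pi.single l x)
    have h1 : ∀ w, ∑ l', inner ℝ (Pi.single (M := fun _ => H) l x l') (W l' w) =
        inner ℝ x (W l w) := fun w =>
      sum_inner_single (fun l => W l w) x l
    have h2 : ∑ l', B (Pi.single (M := fun _ => H) l x l') (Pi.single (M := fun _ => H) l x l') =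
        B x x := by
      rw [Finset.sum_eq_single l _ (by simp)]
      · simp
      · intro l' _ hl
        simp [Pi.single_eq_of_ne hl]
    simp_rw [h1] at hlaw
    rw [h2] at hlaw
    have h3 := lintegral_map' (μ := P) (f := fun y : ℝ => ENNReal.ofReal (y ^ 2)) (by fun_prop)
      (hW.aemeasurable_inner x l)
    have h5 : Integrable (fun y : ℝ => y ^ 2) (gaussianReal 0 (B x x).toNNReal) :=
      (memLp_id_gaussianReal 2).integrable_sq
    rw [← h3, hlaw, ← ofReal_integral_eq_lintegral_ofReal h5
      (Filter.Eventually.of_forall fun y => sq_nonneg _)]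
    congr 1
    have h4 := variance_fun_id_gaussianReal (μ := 0) (v := (B x x).toNNReal)
    rw [variance_eq_integral (by fun_prop), integral_id_gaussianReal,
      Real.coe_toNNReal _ (hW.nonneg x)] at h4
    simpa using h4
  simp_rw [EuclideanSpace.real_norm_sq_eq, coeffVec]
  simp_rw [ENNReal.ofReal_sum_of_nonneg fun _ _ => sq_nonneg _]
  rw [lintegral_finsetSum' _ fun l _ => ((hW.aemeasurable_inner x l).pow_const 2).ennreal_ofReal]
  simp_rw [hone]
  rw [ENNReal.ofReal_mul (Nat.cast_nonneg _)]
  simp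

variable [IsProbabilityMeasure P]

/-- Cramér–Wold: a linear functional of several such sums is again a sum of this form, and its law
is prescribed by `law`. -/
theorem hasGaussianLaw (hW : IsGaussianSample B P W) {ι : Type*} [Finite ι]
    (h : ι → Fin ℓ → H) :
    HasGaussianLaw (fun w i => ∑ l, inner ℝ (h i l) (W l w)) P := by
  have := Fintype.ofFinite ι
  have hm : AEMeasurable (fun w i => ∑ l, inner ℝ (h i l) (W l w)) P :=
    aemeasurable_pi_lambda _ fun i => hW.aemeasurable_sum_inner (h i)
  have hP := Measure.isProbabilityMeasure_map hm
  classical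
  refine ⟨⟨fun L => ?_⟩⟩
  have hL : L ∘ (fun w i => ∑ l, inner ℝ (h i l) (W l w)) =
      fun w => ∑ l, inner ℝ (∑ i, L (fun j => if i = j then 1 else 0) • h i l) (W l w) := by
    ext w
    have h1 := LinearMap.pi_apply_eq_sum_univ (L : (ι → ℝ) →ₗ[ℝ] ℝ)
      (fun i => ∑ l, inner ℝ (h i l) (W l w))
    simp only [ContinuousLinearMap.coe_coe] at h1
    simp only [Function.comp_apply, h1, sum_inner, inner_smul_left, smul_eq_mul, Finset.sum_mul]
    rw [Finset.sum_comm]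
    refine Finset.sum_congr rfl fun l _ => Finset.sum_congr rfl fun i _ => ?_
    simp [mul_comm]
  have hmap := hW.law fun l => ∑ i, L (fun j => if i = j then 1 else 0) • h i l
  rw [← hL, ← AEMeasurable.map_map_of_aemeasurable (by fun_prop) hm] at hmap
  have hmean : (P.map (fun w i => ∑ l, inner ℝ (h i l) (W l w)))[L] = 0 := by
    have h1 := integral_map (μ := P.map (fun w i => ∑ l, inner ℝ (h i l) (W l w))) (φ := L)
      (by fun_prop) (f := id) (by fun_prop)
    rw [hmap] at h1
    simpa using h1.symm
  have hvar := variance_map (X := id) (Y := L)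
    (μ := P.map (fun w i => ∑ l, inner ℝ (h i l) (W l w)))
    aemeasurable_id (by fun_prop)
  rw [hmap, variance_id_gaussianReal, Function.id_comp] at hvar
  rw [hmean, ← hvar, Real.toNNReal_coe, hmap]

theorem memLp_sum_inner (hW : IsGaussianSample B P W) (h : Fin ℓ → H) :
    MemLp (fun w => ∑ l, inner ℝ (h l) (W l w)) 2 P :=
  ((hW.hasGaussianLaw fun _ : Unit => h).eval ()).memLp_two

theorem covariance_sum_inner (hW : IsGaussianSample B P W) (h h' : Fin ℓ → H) :
    cov[fun w => ∑ l, inner ℝ (h l) (W l w), fun w => ∑ l, inner ℝ (h' l) (W l w); P] =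
      ∑ l, B (h l) (h' l) := by
  have h1 := variance_fun_add (hW.memLp_sum_inner h) (hW.memLp_sum_inner h')
  simp_rw [← Finset.sum_add_distrib, ← inner_add_left] at h1
  rw [hW.variance_sum_inner fun l => h l + h' l, hW.variance_sum_inner, hW.variance_sum_inner] at h1
  simp only [map_add, LinearMap.add_apply, Finset.sum_add_distrib] at h1
  have h2 : ∑ l, B (h' l) (h l) = ∑ l, B (h l) (h' l) :=
    Finset.sum_congr rfl fun l _ => hW.symm _ _
  linarith

theorem map_coeffVec (hW : IsGaussianSample B P W) {x : H} (hx : B x x = 1) :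
    P.map (fun w => coeffVec (fun l => W l w) x) = stdGaussian (EuclideanSpace ℝ (Fin ℓ)) := by
  have hP := Measure.isProbabilityMeasure_map (hW.aemeasurable_coeffVec x)
  apply Measure.ext_of_charFun
  ext t
  rw [charFun_apply, integral_map (hW.aemeasurable_coeffVec x) (by fun_prop), charFun_stdGaussian]
  simp_rw [inner_coeffVec]
  have h1 := hW.law fun l => t l • x
  have h2 : ∑ l, B (t l • x) (t l • x) = ‖t‖ ^ 2 := by
    rw [EuclideanSpace.real_norm_sq_eq]
    simp [hx, sq]
  rw [h2] at h1
  have h3 := charFun_apply_real (μ := P.map (fun w => ∑ l, inner ℝ (t l • x) (W l w))) 1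
  rw [integral_map (hW.aemeasurable_sum_inner _) (by fun_prop), h1, charFun_gaussianReal] at h3
  simp only [Complex.ofReal_one, one_mul] at h3
  rw [← h3]
  simp [neg_div]

/-- All the coordinates are jointly Gaussian. Covariances between different columns vanish and those
within a column are `B x (y i) = 0`, so uncorrelatedness gives independence. -/
theorem indepFun_coeffVec (hW : IsGaussianSample B P W) {ι : Type*} [Finite ι] {x : H} {y : ι → H}
    (hxy : ∀ i, B x (y i) = 0) :
    IndepFun (fun w i => coeffVec (fun l => W l w) (y i))
      (fun w => coeffVec (fun l => W l w) x) P := by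
  classical
  have hsingle : ∀ (z : H) (l : Fin ℓ) (w : S),
      ∑ l', inner ℝ (Pi.single (M := fun _ => H) l z l') (W l' w) = inner ℝ z (W l w) :=
    fun z l w => sum_inner_single _ z l
  let a : Fin ℓ → Fin ℓ → H := fun l => Pi.single l x
  let b : ι × Fin ℓ → Fin ℓ → H := fun i => Pi.single i.2 (y i.1)
  have hG := hW.hasGaussianLaw (Sum.elim b a)
  let proj : ((ι × Fin ℓ) ⊕ Fin ℓ → ℝ) →L[ℝ] ((ι × Fin ℓ → ℝ) × (Fin ℓ → ℝ)) :=
    ContinuousLinearMap.prod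
      (ContinuousLinearMap.pi fun i => ContinuousLinearMap.proj (Sum.inl i))
      (ContinuousLinearMap.pi fun i => ContinuousLinearMap.proj (Sum.inr i))
  have := Fintype.ofFinite ι
  have hG' := hG.map_fun proj
  have hind := HasGaussianLaw.indepFun_of_covariance_eval
    (X := fun i w => ∑ l, inner ℝ (b i l) (W l w)) (Y := fun i w => ∑ l, inner ℝ (a i l) (W l w))
    hG' (fun i j => by
      rw [hW.covariance_sum_inner]
      refine Finset.sum_eq_zero fun l _ => ?_
      rw [hW.symm]
      by_cases h1 : l = i.2
      · by_cases h2 : l = j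
        · subst h2
          simp [a, b, ← h1, hxy]
        · simp [a, Pi.single_eq_of_ne h2]
      · simp [b, Pi.single_eq_of_ne h1])
  have hind' := hind.comp
    (φ := fun (z : ι × Fin ℓ → ℝ) (i : ι) => (WithLp.toLp 2 fun l => z (i, l) :
      EuclideanSpace ℝ (Fin ℓ)))
    (ψ := fun z : Fin ℓ → ℝ => (WithLp.toLp 2 z : EuclideanSpace ℝ (Fin ℓ)))
    (by fun_prop) (by fun_prop)
  convert hind' using 1
  · ext w i l
    simp [coeffVec, b, hsingle]
  · ext w l
    simp [coeffVec, a, hsingle]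

theorem lintegral_comp_coeffVec (hW : IsGaussianSample B P W) {x : H} (hx : 0 < B x x)
    {f : ℝ → ℝ≥0∞} (hf : Measurable f) :
    ∫⁻ w, f (‖coeffVec (fun l => W l w) x‖ ^ 2) ∂P =
      ∫⁻ r, f (B x x * ‖r‖ ^ 2) ∂(stdGaussian (EuclideanSpace ℝ (Fin ℓ))) := by
  set c := (√(B x x))⁻¹ with hc
  have hsq : √(B x x) ^ 2 = B x x := Real.sq_sqrt hx.le
  have hs : 0 < √(B x x) := Real.sqrt_pos.2 hx
  have hy : B (c • x) (c • x) = 1 := by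
    simp only [map_smul, LinearMap.smul_apply, smul_eq_mul]
    rw [hc, ← mul_assoc, ← sq, inv_pow, hsq]
    exact inv_mul_cancel₀ hx.ne'
  rw [← hW.map_coeffVec hy, lintegral_map' (by fun_prop) (hW.aemeasurable_coeffVec _)]
  refine lintegral_congr fun w => ?_
  rw [coeffVec_smul, norm_smul, mul_pow, Real.norm_eq_abs, sq_abs, hc, inv_pow, hsq, ← mul_assoc,
    mul_inv_cancel₀ hx.ne', one_mul]

theorem lintegral_exp_mul_norm_coeffVec_sq (hW : IsGaussianSample B P W) {x : H} (hx : 0 < B x x)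
    {a : ℝ} (ha : a * B x x < 1 / 2) :
    ∫⁻ w, ENNReal.ofReal (Real.exp (a * ‖coeffVec (fun l => W l w) x‖ ^ 2)) ∂P =
      ENNReal.ofReal ((1 - 2 * (a * B x x)) ^ (-(ℓ / 2) : ℝ)) := by
  rw [hW.lintegral_comp_coeffVec hx (f := fun y => ENNReal.ofReal (Real.exp (a * y)))
    (by fun_prop), ← lintegral_exp_mul_norm_sq_stdGaussian ℓ ha]
  simp_rw [mul_assoc]

/-- Inverse moments of the distance from a Gaussian coefficient vector to the span of others that
are uncorrelated with it. -/
theorem lintegral_norm_residual_rpow_neg_le (hW : IsGaussianSample B P W) {ι : Type*} [Finite ι]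
    {x : H} {y : ι → H} (hx : B x x = 1) (hxy : ∀ i, B x (y i) = 0) {n : ℕ}
    (hn : n + Nat.card ι ≤ ℓ) {q : ℝ} (hq : 0 < q) (hqn : q < n / 2) :
    ∫⁻ w, ENNReal.ofReal (‖residual (fun i => coeffVec (fun l => W l w) (y i))
        (coeffVec (fun l => W l w) x)‖ ^ 2) ^ (-q) ∂P ≤ ENNReal.ofReal (invChiSqMoment n q) := by
  have hY : AEMeasurable (fun w i => coeffVec (fun l => W l w) (y i)) P :=
    aemeasurable_pi_lambda _ fun i => hW.aemeasurable_coeffVec (y i)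
  have hX := hW.aemeasurable_coeffVec x
  -- Independence makes the joint law a product, so the bound for a fixed family `Y` applies inside
  -- the integral.
  have hprod := (indepFun_iff_map_prod_eq_prod_map_map hY hX).1 (hW.indepFun_coeffVec hxy)
  rw [hW.map_coeffVec hx] at hprod
  have hmeas : Measurable fun z : (ι → EuclideanSpace ℝ (Fin ℓ)) × EuclideanSpace ℝ (Fin ℓ) =>
      ENNReal.ofReal (‖residual z.1 z.2‖ ^ 2) ^ (-q) := by
    have := measurable_norm_residual
      (Z := fun z : (ι → EuclideanSpace ℝ (Fin ℓ)) × EuclideanSpace ℝ (Fin ℓ) => z.2)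
      (Y := fun i z => z.1 i) (by fun_prop) (fun i => by fun_prop)
    fun_prop
  have hP := Measure.isProbabilityMeasure_map hY
  calc _ = ∫⁻ z, ENNReal.ofReal (‖residual z.1 z.2‖ ^ 2) ^ (-q)
        ∂(P.map fun w => ((fun i => coeffVec (fun l => W l w) (y i)),
          coeffVec (fun l => W l w) x)) :=
        (lintegral_map' hmeas.aemeasurable (hY.prodMk hX)).symm
    _ = ∫⁻ y, ∫⁻ r, ENNReal.ofReal (‖residual y r‖ ^ 2) ^ (-q)
        ∂(stdGaussian (EuclideanSpace ℝ (Fin ℓ)))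
        ∂(P.map fun w i => coeffVec (fun l => W l w) (y i)) := by
        rw [hprod, lintegral_prod _ hmeas.aemeasurable]
    _ ≤ ∫⁻ _, ENNReal.ofReal (invChiSqMoment n q)
        ∂(P.map fun w i => coeffVec (fun l => W l w) (y i)) :=
        lintegral_mono fun y => lintegral_norm_residual_sq_rpow_neg_le y hn hq hqn
    _ = _ := by simp

/-- The diagonal entries of an inverse Wishart matrix have the moments of inverse chi-square
variables. -/
theorem lintegral_coeffResidual_rpow_neg_le {k p : ℕ} {W : Fin (k + p) → S → H}
    (hW : IsGaussianSample B P W) {v : ℕ → H} {C : Matrix (Fin k) (Fin k) ℝ}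
    (hC : ∀ i j : Fin k, C i j = B (v i) (v j)) (hpos : C.PosDef) (j : Fin k) {q : ℝ} (hq : 0 < q)
    (hqn : q < (p + 1 : ℕ) / 2) :
    ∫⁻ w, ENNReal.ofReal (‖coeffResidual (fun l => W l w) v j‖ ^ 2) ^ (-q) ∂P ≤
      ENNReal.ofReal (C⁻¹ j j) ^ q * ENNReal.ofReal (invChiSqMoment (p + 1) q) := by
  set A := C⁻¹ with hA
  have hAjj : 0 < A j j := hpos.inv.diag_pos
  have hAC : A * C = 1 := Matrix.nonsing_inv_mul C ((Matrix.isUnit_iff_isUnit_det C).1 hpos.isUnit)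
  set s := √(A j j) with hs
  have hs2 : s * s = A j j := Real.mul_self_sqrt hAjj.le
  have hs0 : 0 < s := Real.sqrt_pos.2 hAjj
  -- `z` is `B`-dual to `v j` within the span of the leading `v i`; its variance is `A j j`.
  set z : H := ∑ i, A j i • v i with hz
  have hzv : ∀ m : Fin k, B z (v m) = if m = j then 1 else 0 := by
    intro m
    have h1 : (A * C) j m = if m = j then 1 else 0 := by
      rw [hAC, Matrix.one_apply]
      simp [eq_comm]
    rw [← h1, Matrix.mul_apply, hz, map_sum, LinearMap.sum_apply]
    simp [hC]
  have hzz : B z z = A j j := by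
    conv_lhs => rw [hz, map_sum]
    simp only [map_smul, smul_eq_mul, ← hz, hzv]
    simp
  set x := s⁻¹ • z with hx
  have hxx : B x x = 1 := by
    simp only [hx, map_smul, LinearMap.smul_apply, hzz, ← hs2, smul_eq_mul]
    field_simp
  have hxv : ∀ i : {i : Fin k // i ≠ j}, B x (v i) = 0 := by
    intro i
    rw [hx, map_smul, LinearMap.smul_apply, hzv, if_neg i.2, smul_zero]
  have hres : ∀ w, ENNReal.ofReal (‖coeffResidual (fun l => W l w) v j‖ ^ 2) ^ (-q) =
      ENNReal.ofReal (A j j) ^ q * ENNReal.ofReal (‖residual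
        (fun i : {i : Fin k // i ≠ j} => coeffVec (fun l => W l w) (v i))
        (coeffVec (fun l => W l w) x)‖ ^ 2) ^ (-q) := by
    intro w
    set Y := fun i : {i : Fin k // i ≠ j} => coeffVec (fun l => W l w) (v i) with hY
    have h1 : coeffVec (fun l => W l w) x = (s⁻¹ * A j j) • coeffVec (fun l => W l w) (v j) +
        ∑ i : {i : Fin k // i ≠ j}, (s⁻¹ * A j i) • coeffVec (fun l => W l w) (v i) := by
      rw [hx, coeffVec_smul, hz, coeffVec_sum]
      simp_rw [coeffVec_smul]
      rw [Finset.smul_sum, Fintype.sum_eq_add_sum_subtype_ne _ j]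
      simp_rw [smul_smul]
    -- The other coefficient vectors do not affect the residual, and `s⁻¹ * A j j = s`.
    have h2 : residual Y (coeffVec (fun l => W l w) x) =
        s • coeffResidual (fun l => W l w) v j := by
      rw [h1, residual_add, residual_smul, ← hs2, coeffResidual]
      · congr 1
        field_simp
      · exact Submodule.sum_mem _ fun i _ =>
          Submodule.smul_mem _ _ (Submodule.subset_span (Set.mem_range_self i))
    rw [h2, norm_smul, mul_pow, Real.norm_eq_abs, sq_abs, sq s, hs2,
      ENNReal.ofReal_mul hAjj.le, ENNReal.mul_rpow_of_ne_top ENNReal.ofReal_ne_top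
        ENNReal.ofReal_ne_top, ← mul_assoc, ← ENNReal.rpow_add _ _ (by simpa using hAjj)
        ENNReal.ofReal_ne_top]
    simp
  simp_rw [hres]
  rw [lintegral_const_mul'' _ (by
    have := aemeasurable_norm_residual (P := P)
      (Z := fun w => coeffVec (fun l => W l w) x)
      (Y := fun (i : {i : Fin k // i ≠ j}) w => coeffVec (fun l => W l w) (v i))
      (hW.aemeasurable_coeffVec x).aestronglyMeasurable
      fun i => (hW.aemeasurable_coeffVec _).aestronglyMeasurable
    exact (this.pow_const 2).ennreal_ofReal.pow_const _)]
  gcongr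
  refine hW.lintegral_norm_residual_rpow_neg_le hxx hxv ?_ hq hqn
  -- The `k - 1` other vectors leave `k + p - (k - 1) = p + 1` degrees of freedom.
  have hj := j.2
  simp only [ne_eq, Nat.card_eq_fintype_card, Fintype.card_subtype_compl, Fintype.card_fin,
    Fintype.card_unique]
  omega

end IsGaussianSample

end Sample

/-! ### Bounds for the randomized singular value decomposition -/

/-- Jensen's inequality for countably many weights, from the tangent line of `exp` at the mean `m`.
-/
theorem ofReal_exp_le_tsum {w x : ℕ → ℝ} {m : ℝ} (hw : ∀ j, 0 ≤ w j) (hw1 : HasSum w 1)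
    (hm : HasSum (fun j => w j * x j) m) :
    ENNReal.ofReal (Real.exp m) ≤ ∑' j, ENNReal.ofReal (w j * Real.exp (x j)) := by
  by_cases htop : ∑' j, ENNReal.ofReal (w j * Real.exp (x j)) = ∞
  · rw [htop]
    exact le_top
  have hnn : ∀ j, 0 ≤ w j * Real.exp (x j) := fun j => mul_nonneg (hw j) (Real.exp_pos _).le
  have hs : Summable fun j => w j * Real.exp (x j) := by
    simpa only [ENNReal.toReal_ofReal (hnn _)] using ENNReal.summable_toReal htop
  rw [← ENNReal.ofReal_tsum_of_nonneg hnn hs]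
  refine ENNReal.ofReal_le_ofReal ?_
  have h1 := (((hw1.mul_left (1 - m)).add hm).mul_left (Real.exp m))
  have h2 : Real.exp m * ((1 - m) * 1 + m) = Real.exp m := by ring
  rw [h2] at h1
  refine hasSum_le (fun j => ?_) h1 hs.hasSum
  have h3 : Real.exp m * (1 + (x j - m)) ≤ Real.exp (x j) := by
    calc _ ≤ Real.exp m * Real.exp (x j - m) := by
          gcongr
          linarith [Real.add_one_le_exp (x j - m)]
      _ = _ := by rw [← Real.exp_add]; congr 1; ring
  calc _ = w j * (Real.exp m * (1 + (x j - m))) := by ring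
    _ ≤ _ := mul_le_mul_of_nonneg_left h3 (hw j)

section Bounds

variable {H : Type*} [NormedAddCommGroup H] [InnerProductSpace ℝ H]
  {S : Type*} [MeasurableSpace S]
  {B : LinearMap.BilinForm ℝ H} {P : Measure S} {k p : ℕ}
  {W : Fin (k + p) → S → H} {σ : ℕ → ℝ} {v : ℕ → H}

/-- The squared Frobenius norm of the pseudo-inverse of the leading coefficient matrix. -/
noncomputable def pinvEnergy {ℓ : ℕ} (v : ℕ → H) (k : ℕ) (om : Fin ℓ → H) : ℝ≥0∞ :=
  ∑ j : Fin k, (ENNReal.ofReal (‖coeffResidual om v j‖ ^ 2))⁻¹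

/-- In `ℝ≥0∞` the inverse of zero is `∞`, so finiteness of the energy encodes the nondegeneracy of
all the residuals. -/
theorem svdError_sq_le_of_pinvEnergy_le {H₂ : Type*} [NormedAddCommGroup H₂]
    [InnerProductSpace ℝ H₂] [CompleteSpace H] [CompleteSpace H₂] {ℓ : ℕ}
    {F : H →L[ℝ] H₂} {u : ℕ → H₂}
    (h : IsSVD F σ v u) {e : HilbertBasis ℕ ℝ H} (hF : IsHilbertSchmidt e F)
    (om : Fin ℓ → H) (hfin : pinvEnergy v k om ≠ ∞) :
    svdError e F om ^ 2 ≤ ∑' j, σ (k + j) ^ 2 +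
      (pinvEnergy v k om).toReal * tailEnergy σ v k om := by
  have hne : ∀ j : Fin k, (ENNReal.ofReal (‖coeffResidual om v j‖ ^ 2))⁻¹ ≠ ∞ := fun j =>
    ENNReal.sum_ne_top.1 hfin j (Finset.mem_univ j)
  have hpos : ∀ j : Fin k, coeffResidual om v j ≠ 0 := by
    intro j h0
    exact hne j (by simp [h0])
  refine (svdError_sq_le h hF om k hpos).trans_eq ?_
  rw [pinvEnergy, ENNReal.toReal_sum fun j _ => hne j]
  simp_rw [ENNReal.toReal_inv, ENNReal.toReal_ofReal (sq_nonneg _)]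

theorem tailEnergy_nonneg {ℓ : ℕ} (σ : ℕ → ℝ) (v : ℕ → H) (k : ℕ) (om : Fin ℓ → H) :
    0 ≤ tailEnergy σ v k om :=
  tsum_nonneg fun _ => by positivity

namespace IsGaussianSample

theorem aemeasurable_norm_coeffResidual {ℓ : ℕ} {W : Fin ℓ → S → H}
    (hW : IsGaussianSample B P W) (v : ℕ → H) (j : Fin k) :
    AEMeasurable (fun w => ‖coeffResidual (fun l => W l w) v j‖) P :=
  aemeasurable_norm_residual (Z := fun w => coeffVec (fun l => W l w) (v j))
    (Y := fun (i : {i : Fin k // i ≠ j}) w => coeffVec (fun l => W l w) (v i))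
    (hW.aemeasurable_coeffVec _).aestronglyMeasurable
    fun _ => (hW.aemeasurable_coeffVec _).aestronglyMeasurable

theorem aemeasurable_pinvEnergy {ℓ : ℕ} {W : Fin ℓ → S → H} (hW : IsGaussianSample B P W)
    (v : ℕ → H) (k : ℕ) : AEMeasurable (fun w => pinvEnergy v k fun l => W l w) P :=
  Finset.aemeasurable_fun_sum _ fun j _ =>
    ((hW.aemeasurable_norm_coeffResidual v j).pow_const 2).ennreal_ofReal.inv

theorem ofReal_tailEnergy {ℓ : ℕ} (hv : Orthonormal ℝ v) (hσ : Summable fun j => σ j ^ 2)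
    (om : Fin ℓ → H) : ENNReal.ofReal (tailEnergy σ v k om) =
      ∑' j, ENNReal.ofReal (σ (k + j) ^ 2) *
        ENNReal.ofReal (‖coeffVec om (v (k + j))‖ ^ 2) := by
  rw [tailEnergy, ENNReal.ofReal_tsum_of_nonneg (fun _ => by positivity)
    (summable_tailEnergy hv hσ k om)]
  simp_rw [ENNReal.ofReal_mul (sq_nonneg (σ _))]

theorem aemeasurable_tailEnergy {ℓ : ℕ} {W : Fin ℓ → S → H} (hW : IsGaussianSample B P W)
    (hv : Orthonormal ℝ v) (hσ : Summable fun j => σ j ^ 2) (k : ℕ) :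
    AEMeasurable (fun w => tailEnergy σ v k fun l => W l w) P := by
  have h : AEMeasurable (fun w => ENNReal.ofReal (tailEnergy σ v k fun l => W l w)) P := by
    simp_rw [ofReal_tailEnergy hv hσ]
    exact AEMeasurable.tsum fun j =>
      ((hW.aemeasurable_coeffVec _).norm.pow_const 2).ennreal_ofReal.const_mul _
  simpa only [ENNReal.toReal_ofReal (tailEnergy_nonneg σ v k _)] using h.ennreal_toReal

theorem lintegral_tailEnergy_le {ℓ : ℕ} {W : Fin ℓ → S → H} (hW : IsGaussianSample B P W)
    (hv : Orthonormal ℝ v) (hσ : Summable fun j => σ j ^ 2) {Λ : ℝ}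
    (hΛ : ∀ x, B x x ≤ Λ * ‖x‖ ^ 2) :
    ∫⁻ w, ENNReal.ofReal (tailEnergy σ v k fun l => W l w) ∂P ≤
      ENNReal.ofReal (ℓ * Λ * ∑' j, σ (k + j) ^ 2) := by
  have hΛ0 : 0 ≤ Λ := by
    have := (hW.nonneg (v 0)).trans (hΛ (v 0))
    simpa [hv.1] using this
  have hσ' : Summable fun j => σ (k + j) ^ 2 := hσ.comp_injective (add_right_injective k)
  simp_rw [ofReal_tailEnergy hv hσ]
  rw [lintegral_tsum fun j =>
    ((hW.aemeasurable_coeffVec _).norm.pow_const 2).ennreal_ofReal.const_mul _]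
  rw [← tsum_mul_left, ENNReal.ofReal_tsum_of_nonneg (fun _ => by positivity) (hσ'.mul_left _)]
  refine ENNReal.tsum_le_tsum fun j => ?_
  rw [lintegral_const_mul'' _ ((hW.aemeasurable_coeffVec _).norm.pow_const 2).ennreal_ofReal,
    hW.lintegral_norm_coeffVec_sq, ← ENNReal.ofReal_mul (sq_nonneg _)]
  refine ENNReal.ofReal_le_ofReal ?_
  have := hΛ (v (k + j))
  rw [hv.1, one_pow, mul_one] at this
  rw [mul_comm]
  gcongr

variable [IsProbabilityMeasure P]

theorem lintegral_pinvEnergy_le (hW : IsGaussianSample B P W) (hp : 2 ≤ p)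
    {C : Matrix (Fin k) (Fin k) ℝ}
    (hC : ∀ i j : Fin k, C i j = B (v i) (v j)) (hpos : C.PosDef) :
    ∫⁻ w, pinvEnergy v k (fun l => W l w) ∂P ≤
      ENNReal.ofReal (C⁻¹.trace / ((p : ℝ) - 1)) := by
  have hp' : (2 : ℝ) ≤ p := by exact_mod_cast hp
  have hA : ∀ j, 0 ≤ C⁻¹ j j := fun j => hpos.inv.diag_pos.le
  simp_rw [pinvEnergy]
  have hm : ∀ j : Fin k, AEMeasurable
      (fun w => (ENNReal.ofReal (‖coeffResidual (fun l => W l w) v j‖ ^ 2))⁻¹) P := fun j =>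
    ((hW.aemeasurable_norm_coeffResidual v j).pow_const 2).ennreal_ofReal.inv
  rw [lintegral_finsetSum' _ fun j _ => hm j]
  have h1 : ∀ j : Fin k, ∫⁻ w, (ENNReal.ofReal (‖coeffResidual (fun l => W l w) v j‖ ^ 2))⁻¹ ∂P ≤
      ENNReal.ofReal (C⁻¹ j j * (1 / ((p : ℝ) - 1))) := by
    intro j
    have h2 := hW.lintegral_coeffResidual_rpow_neg_le hC hpos j one_pos
      (by push_cast; linarith)
    rw [invChiSqMoment_one hp, ENNReal.rpow_one, ← ENNReal.ofReal_mul (hA j)] at h2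
    simpa only [ENNReal.rpow_neg_one] using h2
  refine (Finset.sum_le_sum fun j _ => h1 j).trans_eq ?_
  have h3 : 0 ≤ 1 / ((p : ℝ) - 1) := by
    have : 0 < (p : ℝ) - 1 := by linarith
    positivity
  rw [← ENNReal.ofReal_sum_of_nonneg fun j _ => mul_nonneg (hA j) h3, ← Finset.sum_mul,
    Matrix.trace]
  simp [div_eq_mul_inv]

/-- Convexity of `x ^ q` with weights proportional to the diagonal of `C⁻¹` yields exactly the
trace, with no extra factor in `k` and no independence of the summands. -/
theorem lintegral_pinvEnergy_rpow_le (hW : IsGaussianSample B P W) (hk : 1 ≤ k) (hp : 4 ≤ p)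
    {C : Matrix (Fin k) (Fin k) ℝ}
    (hC : ∀ i j : Fin k, C i j = B (v i) (v j)) (hpos : C.PosDef) :
    ∫⁻ w, pinvEnergy v k (fun l => W l w) ^ ((p : ℝ) / 2) ∂P ≤
      ENNReal.ofReal (C⁻¹.trace * (3 / ((p : ℝ) + 1))) ^ ((p : ℝ) / 2) := by
  have hp' : (4 : ℝ) ≤ p := by exact_mod_cast hp
  have hA : ∀ j, 0 < C⁻¹ j j := fun j => hpos.inv.diag_pos
  set q : ℝ := (p : ℝ) / 2 with hq
  have hq0 : 0 < q := by positivity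
  set a : Fin k → ℝ≥0∞ := fun j => ENNReal.ofReal (C⁻¹ j j) with ha
  have ha0 : ∀ j, a j ≠ 0 := fun j => by simpa [ha] using hA j
  have hat : ∀ j, a j ≠ ∞ := fun j => ENNReal.ofReal_ne_top
  have hTsum : ENNReal.ofReal C⁻¹.trace = ∑ j, a j := by
    simp only [Matrix.trace, Matrix.diag_apply]
    rw [ENNReal.ofReal_sum_of_nonneg fun j _ => (hA j).le]
  have htr : 0 ≤ C⁻¹.trace := Finset.sum_nonneg fun j _ => (hA j).le
  set T := ENNReal.ofReal C⁻¹.trace with hT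
  have hTt : T ≠ ∞ := ENNReal.ofReal_ne_top
  have hT0 : T ≠ 0 := by
    rw [hTsum]
    exact fun h => ha0 ⟨0, hk⟩ (Finset.sum_eq_zero_iff.1 h _ (Finset.mem_univ _))
  set m := ENNReal.ofReal (invChiSqMoment (p + 1) q)
  let Z : Fin k → S → ℝ≥0∞ :=
    fun j w => (ENNReal.ofReal (‖coeffResidual (fun l => W l w) v j‖ ^ 2))⁻¹
  have hZ : ∀ j, AEMeasurable (Z j) P := fun j =>
    ((hW.aemeasurable_norm_coeffResidual v j).pow_const 2).ennreal_ofReal.inv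
  have hZm : ∀ j, ∫⁻ w, Z j w ^ q ∂P ≤ a j ^ q * m := by
    intro j
    have h2 := hW.lintegral_coeffResidual_rpow_neg_le hC hpos j hq0
      (by push_cast; rw [hq]; linarith)
    simpa only [Z, ENNReal.inv_rpow, ENNReal.rpow_neg] using h2
  have hpt : ∀ w, pinvEnergy v k (fun l => W l w) ^ q ≤
      ∑ j, (a j / T * (T / a j) ^ q) * Z j w ^ q := by
    intro w
    have h1 : ∑ j, a j / T = 1 := by
      simp_rw [div_eq_mul_inv]
      rw [← Finset.sum_mul, ← hTsum, ENNReal.mul_inv_cancel hT0 hTt]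
    have h2 := ENNReal.rpow_arith_mean_le_arith_mean_rpow Finset.univ (fun j => a j / T)
      (fun j => T / a j * Z j w) h1 (p := q) (by rw [hq]; linarith)
    have h3 : ∀ j, a j / T * (T / a j * Z j w) = Z j w := by
      intro j
      calc _ = (a j * (a j)⁻¹) * (T * T⁻¹) * Z j w := by
            simp_rw [div_eq_mul_inv]
            ring
        _ = _ := by
            rw [ENNReal.mul_inv_cancel (ha0 j) (hat j), ENNReal.mul_inv_cancel hT0 hTt, one_mul,
              one_mul]
    simp_rw [h3] at h2
    refine h2.trans_eq (Finset.sum_congr rfl fun j _ => ?_)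
    rw [ENNReal.mul_rpow_of_nonneg _ _ hq0.le, mul_assoc]
  have hmle : m ≤ ENNReal.ofReal (3 / ((p : ℝ) + 1)) ^ q := by
    rw [ENNReal.ofReal_rpow_of_pos (by positivity)]
    exact ENNReal.ofReal_le_ofReal (invChiSqMoment_half_le hp)
  calc _ ≤ ∫⁻ w, ∑ j, (a j / T * (T / a j) ^ q) * Z j w ^ q ∂P := lintegral_mono hpt
    _ = ∑ j, (a j / T * (T / a j) ^ q) * ∫⁻ w, Z j w ^ q ∂P := by
        rw [lintegral_finsetSum' _ fun j _ => ((hZ j).pow_const q).const_mul _]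
        exact Finset.sum_congr rfl fun j _ => lintegral_const_mul'' _ ((hZ j).pow_const q)
    _ ≤ ∑ j, (a j / T * (T / a j) ^ q) * (a j ^ q * m) := by
        gcongr with j
        exact hZm j
    _ = ∑ j, a j / T * (T ^ q * m) := by
        refine Finset.sum_congr rfl fun j _ => ?_
        rw [mul_assoc, ← mul_assoc (_ ^ q), ← ENNReal.mul_rpow_of_nonneg _ _ hq0.le,
          ENNReal.div_mul_cancel (ha0 j) (hat j)]
    _ = T ^ q * m := by
        simp_rw [div_eq_mul_inv]
        rw [← Finset.sum_mul, ← Finset.sum_mul, ← hTsum, ENNReal.mul_inv_cancel hT0 hTt, one_mul]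
    _ ≤ T ^ q * ENNReal.ofReal (3 / ((p : ℝ) + 1)) ^ q := by gcongr
    _ = _ := by
        rw [← ENNReal.mul_rpow_of_nonneg _ _ hq0.le, hT,
          ← ENNReal.ofReal_mul htr]

/-- Markov's inequality for the moment of order `p / 2`: the factor `t ^ 2` in the threshold becomes
`t ^ p`. -/
theorem measure_lt_pinvEnergy_le (hW : IsGaussianSample B P W) (hk : 1 ≤ k) (hp : 4 ≤ p)
    {C : Matrix (Fin k) (Fin k) ℝ}
    (hC : ∀ i j : Fin k, C i j = B (v i) (v j)) (hpos : C.PosDef) {t : ℝ} (ht : 1 ≤ t) :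
    P {w | ENNReal.ofReal (t ^ 2 * (C⁻¹.trace * (3 / ((p : ℝ) + 1)))) <
      pinvEnergy v k fun l => W l w} ≤ ENNReal.ofReal ((t ^ p)⁻¹) := by
  have hq0 : (0 : ℝ) < (p : ℝ) / 2 := by positivity
  have htr : 0 < C⁻¹.trace := by
    have : Nonempty (Fin k) := ⟨⟨0, hk⟩⟩
    exact hpos.inv.trace_pos
  set b := C⁻¹.trace * (3 / ((p : ℝ) + 1)) with hb
  have hb0 : 0 < b := by positivity
  have h1 := hW.lintegral_pinvEnergy_rpow_le hk hp hC hpos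
  rw [← hb] at h1
  have h2 := mul_meas_ge_le_lintegral₀
    ((hW.aemeasurable_pinvEnergy v k).pow_const ((p : ℝ) / 2))
    (ENNReal.ofReal (t ^ 2 * b) ^ ((p : ℝ) / 2))
  have h3 := h2.trans h1
  rw [ENNReal.ofReal_mul (sq_nonneg t), ENNReal.mul_rpow_of_nonneg _ _ hq0.le,
    mul_comm (_ ^ _) (ENNReal.ofReal b ^ _), mul_assoc] at h3
  have hb1 : ENNReal.ofReal b ^ ((p : ℝ) / 2) ≠ 0 := by
    rw [ENNReal.ofReal_rpow_of_pos hb0]; simpa using Real.rpow_pos_of_pos hb0 _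
  have hb2 : ENNReal.ofReal b ^ ((p : ℝ) / 2) ≠ ∞ := by
    rw [ENNReal.ofReal_rpow_of_pos hb0]; exact ENNReal.ofReal_ne_top
  have h4 := (ENNReal.mul_le_mul_iff_right hb1 hb2).1 (h3.trans_eq (mul_one _).symm)
  have h5 : ENNReal.ofReal (t ^ 2) ^ ((p : ℝ) / 2) = ENNReal.ofReal (t ^ p) := by
    rw [ENNReal.ofReal_rpow_of_pos (by positivity), ← Real.rpow_natCast t 2,
      ← Real.rpow_mul (by positivity), ← Real.rpow_natCast t p]
    congr 2
    push_cast
    ring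
  rw [h5] at h4
  refine (measure_mono fun w hw => ?_).trans
    ((ENNReal.le_inv_iff_mul_le.2 ((mul_comm _ _).trans_le h4)).trans_eq
      (ENNReal.ofReal_inv_of_pos (by positivity)).symm)
  rw [← h5, ← ENNReal.mul_rpow_of_nonneg _ _ hq0.le, mul_comm, ← ENNReal.ofReal_mul (sq_nonneg t)]
  exact ENNReal.rpow_le_rpow (le_of_lt hw) hq0.le

/-- A Chernoff bound. The summands are correlated, so Jensen with weights `σ ^ 2 / τ` replaces the
factorization of the exponential moment. -/
theorem measure_lt_tailEnergy_le {ℓ : ℕ} {W : Fin ℓ → S → H} (hW : IsGaussianSample B P W)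
    (hv : Orthonormal ℝ v) (hσ : Summable fun j => σ j ^ 2) {Λ : ℝ}
    (hΛ : ∀ x, B x x ≤ Λ * ‖x‖ ^ 2) (hBpos : ∀ j, 0 < B (v j) (v j)) {s : ℝ} (hs : 1 ≤ s) :
    P {w | s ^ 2 * (ℓ * Λ * ∑' j, σ (k + j) ^ 2) < tailEnergy σ v k fun l => W l w} ≤
      ENNReal.ofReal ((s * Real.exp (-(s ^ 2 - 1) / 2)) ^ ℓ) := by
  have hBΛ : ∀ j, B (v j) (v j) ≤ Λ := fun j => by simpa [hv.1] using hΛ (v j)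
  have hΛ0 : 0 < Λ := (hBpos 0).trans_le (hBΛ 0)
  have hσ' : Summable fun j => σ (k + j) ^ 2 := hσ.comp_injective (add_right_injective k)
  set τ := ∑' j, σ (k + j) ^ 2 with hτ
  have hτ0 : 0 ≤ τ := tsum_nonneg fun _ => sq_nonneg _
  rcases hs.eq_or_lt with rfl | hs
  -- At `s = 1` the bound is 1.
  · simpa using prob_le_one
  rcases hτ0.eq_or_lt with h0 | hτ0
  · have hz : ∀ j, σ (k + j) ^ 2 = 0 := by
      intro j
      have := (hσ'.hasSum_iff.2 h0.symm)
      exact congrFun ((hasSum_zero_iff_of_nonneg fun _ => sq_nonneg _).1 this) j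
    have : ∀ w, tailEnergy σ v k (fun l => W l w) = 0 := fun w => by simp [tailEnergy, hz]
    simp [this, ← h0]
  have hs0 : 0 < s := by linarith
  -- The minimizer in the Chernoff bound: `1 - 2 a Λ = s⁻²`, so each exponential moment is at most
  -- `s ^ ℓ`, and the threshold contributes `exp (ℓ (s² - 1) / 2)`.
  set a := (1 - (s ^ 2)⁻¹) / (2 * Λ) with ha
  have hs2 : (s ^ 2)⁻¹ < 1 := inv_lt_one_of_one_lt₀ (one_lt_pow₀ hs two_ne_zero)
  have ha0 : 0 < a := by
    have : 0 < 1 - (s ^ 2)⁻¹ := by linarith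
    positivity
  have haB : ∀ j, 2 * (a * B (v j) (v j)) ≤ 1 - (s ^ 2)⁻¹ := by
    intro j
    calc _ ≤ 2 * (a * Λ) := by gcongr; exact hBΛ j
      _ = _ := by rw [ha]; field_simp
  have hmgf : ∀ j, ∫⁻ w, ENNReal.ofReal (Real.exp (a * ‖coeffVec (fun l => W l w) (v j)‖ ^ 2)) ∂P ≤
      ENNReal.ofReal (s ^ ℓ) := by
    intro j
    have h1 := haB j
    have h2 : 0 < (s ^ 2)⁻¹ := by positivity
    rw [hW.lintegral_exp_mul_norm_coeffVec_sq (hBpos j) (by linarith)]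
    refine ENNReal.ofReal_le_ofReal ?_
    calc _ ≤ ((s ^ 2)⁻¹) ^ (-(ℓ / 2) : ℝ) := by
          refine Real.rpow_le_rpow_of_nonpos h2 (by linarith) ?_
          have : (0 : ℝ) ≤ ℓ := Nat.cast_nonneg _
          linarith
      _ = s ^ ℓ := by
          rw [Real.rpow_neg h2.le, Real.inv_rpow (by positivity), inv_inv, ← Real.rpow_natCast s 2,
            ← Real.rpow_mul hs0.le, ← Real.rpow_natCast s ℓ]
          congr 1
          push_cast
          ring
  have hR : ∀ w, ENNReal.ofReal (Real.exp (a / τ * tailEnergy σ v k fun l => W l w)) ≤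
      ∑' j, ENNReal.ofReal (σ (k + j) ^ 2 / τ) *
        ENNReal.ofReal (Real.exp (a * ‖coeffVec (fun l => W l w) (v (k + j))‖ ^ 2)) := by
    intro w
    have h1 := ((summable_tailEnergy hv hσ k fun l => W l w).hasSum.mul_left (a / τ))
    have h2 := hσ'.hasSum.div_const τ
    rw [← hτ, div_self hτ0.ne'] at h2
    refine (ofReal_exp_le_tsum (fun j => by positivity) h2
      (x := fun j => a * ‖coeffVec (fun l => W l w) (v (k + j))‖ ^ 2) ?_).trans_eq ?_
    · have h3 : (fun j => σ (k + j) ^ 2 / τ *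
          (a * ‖coeffVec (fun l => W l w) (v (k + j))‖ ^ 2)) = fun j => a / τ *
          (σ (k + j) ^ 2 * ‖coeffVec (fun l => W l w) (v (k + j))‖ ^ 2) := by
        ext j
        ring
      rw [h3]
      exact h1
    · congr 1 with j
      rw [ENNReal.ofReal_mul (by positivity)]
  have hint : ∫⁻ w, ENNReal.ofReal (Real.exp (a / τ * tailEnergy σ v k fun l => W l w)) ∂P ≤
      ENNReal.ofReal (s ^ ℓ) := by
    have hm : ∀ j, AEMeasurable (fun w => ENNReal.ofReal
        (Real.exp (a * ‖coeffVec (fun l => W l w) (v (k + j))‖ ^ 2))) P := fun j =>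
      (Real.measurable_exp.comp_aemeasurable
        (((hW.aemeasurable_coeffVec _).norm.pow_const 2).const_mul a)).ennreal_ofReal
    refine (lintegral_mono hR).trans ?_
    rw [lintegral_tsum fun j => (hm j).const_mul _]
    simp_rw [fun j => lintegral_const_mul'' (ENNReal.ofReal (σ (k + j) ^ 2 / τ)) (hm j)]
    refine (ENNReal.tsum_le_tsum fun j => mul_le_mul_right (hmgf (k + j)) _).trans_eq ?_
    rw [ENNReal.tsum_mul_right, ← ENNReal.ofReal_tsum_of_nonneg (fun _ => by positivity)
      (hσ'.div_const τ), tsum_div_const, ← hτ, div_self hτ0.ne', ENNReal.ofReal_one, one_mul]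
  have hmeas : AEMeasurable (fun w => ENNReal.ofReal
      (Real.exp (a / τ * tailEnergy σ v k fun l => W l w))) P :=
    (Real.measurable_exp.comp_aemeasurable
      ((hW.aemeasurable_tailEnergy hv hσ k).const_mul _)).ennreal_ofReal
  set E := Real.exp ((s ^ 2 - 1) / 2) ^ ℓ with hE
  have hE0 : 0 < E := by positivity
  have hmarkov := (mul_meas_ge_le_lintegral₀ hmeas (ENNReal.ofReal E)).trans hint
  have hsub : P {w | s ^ 2 * (ℓ * Λ * τ) < tailEnergy σ v k fun l => W l w} ≤
      P {w | ENNReal.ofReal E ≤ ENNReal.ofReal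
        (Real.exp (a / τ * tailEnergy σ v k fun l => W l w))} := by
    refine measure_mono fun w hw => ?_
    simp only [Set.mem_ofPred_eq] at hw ⊢
    refine ENNReal.ofReal_le_ofReal ?_
    rw [hE, ← Real.exp_nat_mul]
    refine Real.exp_le_exp.2 ?_
    calc _ = a / τ * (s ^ 2 * (ℓ * Λ * τ)) := by
          rw [ha]
          field_simp
      _ ≤ _ := by gcongr
  refine hsub.trans ?_
  rw [mul_comm, ← ENNReal.le_div_iff_mul_le (by simp [hE0]) (by simp),
    ← ENNReal.ofReal_div_of_pos hE0] at hmarkov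
  refine hmarkov.trans_eq ?_
  rw [hE, mul_pow, neg_div, Real.exp_neg, inv_pow, div_eq_mul_inv]

theorem integrable_svdError {H₂ : Type*} [NormedAddCommGroup H₂] [InnerProductSpace ℝ H₂]
    {F : H →L[ℝ] H₂} {e : HilbertBasis ℕ ℝ H} (hW : IsGaussianSample B P W)
    (hF : IsHilbertSchmidt e F) :
    Integrable (fun w => svdError e F fun l => W l w) P := by
  refine Integrable.of_bound (aestronglyMeasurable_svdError e F hW.aestronglyMeasurable)
    (hsNorm e F) (Filter.Eventually.of_forall fun w => ?_)
  rw [svdError_eq, Real.norm_eq_abs, abs_of_nonneg (Real.sqrt_nonneg _), ← svdError_eq]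
  exact svdError_le_hsNorm _ hF

/-! ### The bounds in expectation and in probability for Gaussian samples. -/

section Main

variable {H₂ : Type*} [NormedAddCommGroup H₂] [InnerProductSpace ℝ H₂] [CompleteSpace H]
  [CompleteSpace H₂] {F : H →L[ℝ] H₂} {u : ℕ → H₂} {e : HilbertBasis ℕ ℝ H}

theorem integral_svdError_le (hW : IsGaussianSample B P W) (hp : 2 ≤ p)
    (h : IsSVD F σ v u) (hF : IsHilbertSchmidt e F) {Λ : ℝ} (hΛ : ∀ x, B x x ≤ Λ * ‖x‖ ^ 2)
    {C : Matrix (Fin k) (Fin k) ℝ}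
    (hC : ∀ i j : Fin k, C i j = B (v i) (v j)) (hpos : C.PosDef) :
    ∫ w, svdError e F (fun l => W l w) ∂P ≤ √(∑' j, σ (k + j) ^ 2) +
      √(C⁻¹.trace / ((p : ℝ) - 1) * (((k + p : ℕ) : ℝ) * Λ * ∑' j, σ (k + j) ^ 2)) := by
  have hp' : (2 : ℝ) ≤ p := by exact_mod_cast hp
  have hσ := h.summable_sq hF
  have hv := h.orthonormal_right
  have hΛ0 : 0 ≤ Λ := by
    have := (hW.nonneg (v 0)).trans (hΛ (v 0))
    simpa [hv.1] using this
  set τ := ∑' j, σ (k + j) ^ 2 with hτ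
  have hτ0 : 0 ≤ τ := tsum_nonneg fun _ => sq_nonneg _
  have htr : 0 ≤ C⁻¹.trace := Finset.sum_nonneg fun j _ => hpos.inv.diag_pos.le
  have hM := hW.lintegral_pinvEnergy_le hp hC hpos
  have hR := hW.lintegral_tailEnergy_le (k := k) hv hσ hΛ
  rw [← hτ] at hR
  set M : S → ℝ≥0∞ := fun w => pinvEnergy v k fun l => W l w with hMdef
  set R : S → ℝ := fun w => tailEnergy σ v k fun l => W l w with hRdef
  have hMm : AEMeasurable M P := hW.aemeasurable_pinvEnergy v k
  have hRm : AEMeasurable R P := hW.aemeasurable_tailEnergy hv hσ k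
  have hfin : ∀ᵐ w ∂P, M w < ∞ := ae_lt_top' hMm (hM.trans_lt ENNReal.ofReal_lt_top).ne
  have hpt : ∀ᵐ w ∂P, ENNReal.ofReal (svdError e F fun l => W l w) ≤
      ENNReal.ofReal √τ + M w ^ (1 / 2 : ℝ) * ENNReal.ofReal (R w) ^ (1 / 2 : ℝ) := by
    filter_upwards [hfin] with w hw
    have h1 := svdError_sq_le_of_pinvEnergy_le h hF (fun l => W l w) hw.ne
    have hR0 : 0 ≤ R w := tailEnergy_nonneg σ v k _
    have hMR : 0 ≤ (M w).toReal * R w := mul_nonneg ENNReal.toReal_nonneg hR0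
    have h2 : svdError e F (fun l => W l w) ≤ √τ + √((M w).toReal * R w) := by
      refine abs_le_of_sq_le_sq' ?_ (by positivity) |>.2
      refine h1.trans ?_
      rw [add_sq, Real.sq_sqrt hτ0, Real.sq_sqrt hMR]
      have : 0 ≤ 2 * √τ * √((M w).toReal * R w) := by positivity
      linarith
    refine (ENNReal.ofReal_le_ofReal h2).trans ?_
    rw [ENNReal.ofReal_add (Real.sqrt_nonneg _) (Real.sqrt_nonneg _)]
    refine add_le_add le_rfl (le_of_eq ?_)
    rw [Real.sqrt_eq_rpow, ← ENNReal.ofReal_rpow_of_nonneg hMR (by norm_num),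
      ENNReal.ofReal_mul ENNReal.toReal_nonneg, ENNReal.ofReal_toReal hw.ne,
      ENNReal.mul_rpow_of_nonneg _ _ (by norm_num)]
  -- Cauchy–Schwarz needs no independence of `M` and `R`.
  have hhold : ∫⁻ w, M w ^ (1 / 2 : ℝ) * ENNReal.ofReal (R w) ^ (1 / 2 : ℝ) ∂P ≤
      (∫⁻ w, M w ∂P) ^ (1 / 2 : ℝ) * (∫⁻ w, ENNReal.ofReal (R w) ∂P) ^ (1 / 2 : ℝ) := by
    have h1 := ENNReal.lintegral_mul_le_Lp_mul_Lq P Real.HolderConjugate.two_two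
      (hMm.pow_const (1 / 2 : ℝ)) (hRm.ennreal_ofReal.pow_const (1 / 2 : ℝ))
    have h2 : ∀ x : ℝ≥0∞, (x ^ (1 / 2 : ℝ)) ^ (2 : ℝ) = x := fun x => by
      rw [← ENNReal.rpow_mul]
      norm_num
    simpa only [Pi.mul_apply, h2] using h1
  have hX : 0 ≤ C⁻¹.trace / ((p : ℝ) - 1) := div_nonneg htr (by linarith)
  have hY : 0 ≤ ((k + p : ℕ) : ℝ) * Λ * τ := by positivity
  have hfinal : ENNReal.ofReal (∫ w, svdError e F (fun l => W l w) ∂P) ≤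
      ENNReal.ofReal (√τ + √(C⁻¹.trace / ((p : ℝ) - 1) * (((k + p : ℕ) : ℝ) * Λ * τ))) := by
    rw [ofReal_integral_eq_lintegral_ofReal (hW.integrable_svdError hF)
      (Filter.Eventually.of_forall fun w => Real.sqrt_nonneg _)]
    refine (lintegral_mono_ae hpt).trans ?_
    rw [lintegral_add_left measurable_const, lintegral_const, measure_univ, mul_one,
      ENNReal.ofReal_add (Real.sqrt_nonneg _) (Real.sqrt_nonneg _)]
    refine add_le_add le_rfl (hhold.trans ?_)
    rw [Real.sqrt_eq_rpow, ← ENNReal.ofReal_rpow_of_nonneg (mul_nonneg hX hY) (by norm_num),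
      ENNReal.ofReal_mul hX, ENNReal.mul_rpow_of_nonneg _ _ (by norm_num)]
    gcongr
  exact (ENNReal.ofReal_le_ofReal_iff (by positivity)).1 hfinal

theorem one_sub_le_measureReal_svdError_le (hW : IsGaussianSample B P W) (hk : 1 ≤ k) (hp : 4 ≤ p)
    (h : IsSVD F σ v u) (hF : IsHilbertSchmidt e F) {Λ : ℝ} (hΛ : ∀ x, B x x ≤ Λ * ‖x‖ ^ 2)
    (hBpos : ∀ j, 0 < B (v j) (v j)) {C : Matrix (Fin k) (Fin k) ℝ}
    (hC : ∀ i j : Fin k, C i j = B (v i) (v j)) (hpos : C.PosDef) {s t : ℝ} (hs : 1 ≤ s)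
    (ht : 1 ≤ t) :
    1 - (t ^ p)⁻¹ - (s * Real.exp (-(s ^ 2 - 1) / 2)) ^ (k + p) ≤
      P.real {w | svdError e F (fun l => W l w) ≤ √(∑' j, σ (k + j) ^ 2 +
        t ^ 2 * (C⁻¹.trace * (3 / ((p : ℝ) + 1))) *
          (s ^ 2 * (((k + p : ℕ) : ℝ) * Λ * ∑' j, σ (k + j) ^ 2)))} := by
  have hσ := h.summable_sq hF
  have hv := h.orthonormal_right
  set X := t ^ 2 * (C⁻¹.trace * (3 / ((p : ℝ) + 1))) with hX
  set Y := s ^ 2 * (((k + p : ℕ) : ℝ) * Λ * ∑' j, σ (k + j) ^ 2) with hY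
  have htr : 0 ≤ C⁻¹.trace := Finset.sum_nonneg fun j _ => hpos.inv.diag_pos.le
  have hX0 : 0 ≤ X := by positivity
  have hb1 := hW.measure_lt_pinvEnergy_le hk hp hC hpos ht
  have hb2 := hW.measure_lt_tailEnergy_le (k := k) hv hσ hΛ hBpos hs
  rw [← hX] at hb1
  rw [← hY] at hb2
  set b1 := {w | ENNReal.ofReal X < pinvEnergy v k fun l => W l w}
  set b2 := {w | Y < tailEnergy σ v k fun l => W l w}
  set g := {w | svdError e F (fun l => W l w) ≤ √(∑' j, σ (k + j) ^ 2 + X * Y)}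
  -- Outside the two exceptional events the deterministic bound applies; subadditivity then
  -- suffices, without measurability of `g`.
  have hcover : Set.univ ⊆ g ∪ (b1 ∪ b2) := by
    intro w _
    by_contra hw
    simp only [Set.mem_union, not_or, g, b1, b2, Set.mem_ofPred_eq, not_lt] at hw
    obtain ⟨hg, h1, h2⟩ := hw
    refine hg ?_
    refine Real.le_sqrt_of_sq_le ((svdError_sq_le_of_pinvEnergy_le h hF (fun l => W l w)
      (h1.trans_lt ENNReal.ofReal_lt_top).ne).trans ?_)
    have h3 : (pinvEnergy v k fun l => W l w).toReal ≤ X := ENNReal.toReal_le_of_le_ofReal hX0 h1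
    have := tailEnergy_nonneg σ v k fun l => W l w
    gcongr
  have h1 : P.real b1 ≤ (t ^ p)⁻¹ := ENNReal.toReal_le_of_le_ofReal (by positivity) hb1
  have h2 : P.real b2 ≤ (s * Real.exp (-(s ^ 2 - 1) / 2)) ^ (k + p) :=
    ENNReal.toReal_le_of_le_ofReal (by positivity) hb2
  have h3 : P.real Set.univ ≤ P.real g + (P.real b1 + P.real b2) :=
    (measureReal_mono hcover).trans ((measureReal_union_le _ _).trans
      (add_le_add le_rfl (measureReal_union_le _ _)))
  rw [probReal_univ] at h3
  linarith

end Main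

end IsGaussianSample

end Bounds

/-! ### The closed linear span of a Gaussian process -/

section GaussianClosure

variable {S : Type*} [MeasurableSpace S] {P : Measure S}

theorem Lp_two_norm_sq_eq_integral (Z : Lp ℝ 2 P) : ‖Z‖ ^ 2 = ∫ w, Z w ^ 2 ∂P := by
  rw [← real_inner_self_eq_norm_sq, L2.inner_def]
  simp [sq]

theorem memLp_two_of_isGaussianProcess {α : Type*} {X : α → S → ℝ} (hG : IsGaussianProcess X P)
    (x : α) : MemLp (X x) 2 P := (hG.hasGaussianLaw_eval x).memLp_two

variable [IsProbabilityMeasure P]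

theorem integral_abs_le_norm_Lp_two (Z : Lp ℝ 2 P) : ∫ w, |Z w| ∂P ≤ ‖Z‖ := by
  have h1 : ∫ w, |Z w| ∂P = (eLpNorm Z 1 P).toReal := by
    rw [eLpNorm_one_eq_lintegral_enorm, ← integral_norm_eq_lintegral_enorm
      (Lp.aestronglyMeasurable Z)]
    rfl
  rw [h1, Lp.norm_def]
  exact ENNReal.toReal_mono (Lp.eLpNorm_ne_top Z)
    (eLpNorm_le_eLpNorm_of_exponent_le one_le_two (Lp.aestronglyMeasurable Z))

theorem norm_exp_mul_I_sub_le (a b : ℝ) :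
    ‖Complex.exp (a * Complex.I) - Complex.exp (b * Complex.I)‖ ≤ |a - b| := by
  have h : Complex.exp (a * Complex.I) - Complex.exp (b * Complex.I) =
      Complex.exp (b * Complex.I) * (Complex.exp (Complex.I * (a - b : ℝ)) - 1) := by
    rw [mul_sub, ← Complex.exp_add, mul_one]
    congr 2
    push_cast
    ring
  rw [h, norm_mul, Complex.norm_exp_ofReal_mul_I, one_mul]
  exact Real.norm_exp_I_mul_ofReal_sub_one_le

theorem integrable_exp_mul_I {f : S → ℝ} (hf : AEStronglyMeasurable f P) :
    Integrable (fun w => Complex.exp (f w * Complex.I)) P := by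
  refine Integrable.of_bound (C := 1) ?_ (Filter.Eventually.of_forall fun w => by
    rw [Complex.norm_exp_ofReal_mul_I])
  exact (by fun_prop : Continuous fun y : ℝ => Complex.exp (y * Complex.I)).comp_aestronglyMeasurable
    hf

/-- Lipschitz with constant `|t|`: `y ↦ exp (i y)` is 1-Lipschitz and the `L¹` norm is at most the
`L²` norm on a probability space. -/
theorem continuous_integral_exp_mul_I (t : ℝ) :
    Continuous fun Z : Lp ℝ 2 P => ∫ w, Complex.exp ((t * Z w : ℝ) * Complex.I) ∂P := by
  refine LipschitzWith.continuous (K := ‖t‖₊) (LipschitzWith.of_dist_le_mul fun Z Z' => ?_)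
  have hm : ∀ Z : Lp ℝ 2 P, Integrable (fun w => Complex.exp ((t * Z w : ℝ) * Complex.I)) P :=
    fun Z => integrable_exp_mul_I ((Lp.aestronglyMeasurable Z).const_mul t)
  rw [dist_eq_norm, ← integral_sub (hm Z) (hm Z'), coe_nnnorm, dist_eq_norm]
  have hint : Integrable (fun w => |t| * |(Z - Z') w|) P :=
    (((Lp.memLp (Z - Z')).integrable one_le_two).abs).const_mul _
  calc ‖∫ w, (Complex.exp ((t * Z w : ℝ) * Complex.I) -
        Complex.exp ((t * Z' w : ℝ) * Complex.I)) ∂P‖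
      ≤ ∫ w, |t| * |(Z - Z') w| ∂P := by
        refine norm_integral_le_of_norm_le hint ?_
        filter_upwards [Lp.coeFn_sub Z Z'] with w hw
        refine (norm_exp_mul_I_sub_le _ _).trans_eq ?_
        rw [hw, Pi.sub_apply, ← mul_sub, abs_mul]
    _ = |t| * ∫ w, |(Z - Z') w| ∂P := integral_const_mul _ _
    _ ≤ _ := by
        rw [Real.norm_eq_abs]
        gcongr
        exact integral_abs_le_norm_Lp_two _

variable {α : Type*} {ℓ : ℕ} {X : Fin ℓ → α → S → ℝ}

theorem integral_exp_sum_mul_I_of_mem_span (hG : ∀ l, IsGaussianProcess (X l) P)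
    (hmean : ∀ l x, ∫ w, X l x w ∂P = 0)
    (hind : iIndepFun (fun l w x => X l x w) P) (Z : Fin ℓ → Lp ℝ 2 P)
    (hZ : ∀ l, Z l ∈ Submodule.span ℝ
      (Set.range fun x => (memLp_two_of_isGaussianProcess (hG l) x).toLp)) (t : ℝ) :
    ∫ w, Complex.exp ((t * (∑ l, Z l) w : ℝ) * Complex.I) ∂P =
      Complex.exp (-(t ^ 2 * ∑ l, ‖Z l‖ ^ 2) / 2 : ℝ) := by
  simp_rw [Finsupp.mem_span_range_iff_exists_finsupp] at hZ
  choose c hc using hZ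
  let Y : Fin ℓ → S → ℝ := fun l w => ∑ x ∈ (c l).support, c l x * X l x w
  have hXint : ∀ l x, Integrable (X l x) P := fun l x =>
    (memLp_two_of_isGaussianProcess (hG l) x).integrable one_le_two
  have hYG : ∀ l, HasGaussianLaw (Y l) P := by
    intro l
    have h1 := ((hG l).hasGaussianLaw (c l).support).map_fun
      (∑ i : (c l).support, c l i • ContinuousLinearMap.proj (R := ℝ)
        (φ := fun _ : (c l).support => ℝ) i)
    refine h1.congr (Filter.Eventually.of_forall fun w => ?_)
    simp only [sum_apply, smul_apply,
      ContinuousLinearMap.proj_apply, smul_eq_mul, Finset.restrict, Y]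
    exact Finset.sum_coe_sort (c l).support fun x => c l x * X l x w
  have hYind : iIndepFun Y P :=
    hind.comp (fun l (f : α → ℝ) => ∑ x ∈ (c l).support, c l x * f x) fun l => by fun_prop
  have hYmean : ∀ l, ∫ w, Y l w ∂P = 0 := by
    intro l
    simp only [Y]
    rw [integral_finsetSum _ fun x _ => (hXint l x).const_mul _]
    simp [integral_const_mul, hmean]
  have hYZ : ∀ l, Z l =ᵐ[P] Y l := by
    intro l
    rw [← hc l, Finsupp.sum]
    refine (Lp.coeFn_finsetSum _ _).trans ?_
    have h1 : ∀ᵐ w ∂P, ∀ x ∈ (c l).support,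
        (c l x • (memLp_two_of_isGaussianProcess (hG l) x).toLp : Lp ℝ 2 P) w =
          c l x * X l x w := by
      refine (Filter.eventually_all_finset _).2 fun x _ => ?_
      filter_upwards [Lp.coeFn_smul (c l x) (memLp_two_of_isGaussianProcess (hG l) x).toLp,
        (memLp_two_of_isGaussianProcess (hG l) x).coeFn_toLp] with w h1 h2
      rw [h1, Pi.smul_apply, h2, smul_eq_mul]
    filter_upwards [h1] with w hw
    rw [Finset.sum_apply]
    exact Finset.sum_congr rfl hw
  have hsumZY : (∑ l, Z l : Lp ℝ 2 P) =ᵐ[P] fun w => ∑ l, Y l w := by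
    refine (Lp.coeFn_finsetSum _ _).trans ?_
    filter_upwards [ae_all_iff.2 hYZ] with w hw
    rw [Finset.sum_apply]
    exact Finset.sum_congr rfl fun l _ => hw l
  have hnorm : ∀ l, Var[Y l; P] = ‖Z l‖ ^ 2 := by
    intro l
    rw [variance_of_integral_eq_zero (hYG l).aemeasurable (hYmean l), Lp_two_norm_sq_eq_integral]
    refine integral_congr_ae ?_
    filter_upwards [hYZ l] with w hw
    rw [hw]
  have hsumG : HasGaussianLaw (fun w => ∑ l, Y l w) P := hYind.hasGaussianLaw_fun_sum hYG
  have hsumvar : Var[fun w => ∑ l, Y l w; P] = ∑ l, ‖Z l‖ ^ 2 := by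
    simp_rw [← hnorm]
    rw [← IndepFun.variance_sum (fun l _ => (hYG l).memLp_two)
      fun i _ j _ hij => hYind.indepFun hij]
    congr 1
    ext w
    simp
  have hsummean : ∫ w, ∑ l, Y l w ∂P = 0 := by
    rw [integral_finsetSum _ fun l _ => (hYG l).integrable]
    simp [hYmean]
  have hlaw := hsumG.map_eq_gaussianReal
  rw [hsumvar, hsummean] at hlaw
  have h3 := charFun_apply_real (μ := P.map (fun w => ∑ l, Y l w)) t
  rw [integral_map hsumG.aemeasurable (by fun_prop), hlaw, charFun_gaussianReal,
    Real.coe_toNNReal _ (Finset.sum_nonneg fun _ _ => sq_nonneg _)] at h3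
  have h4 : ∫ w, Complex.exp ((t * (∑ l, Z l : Lp ℝ 2 P) w : ℝ) * Complex.I) ∂P =
      ∫ w, Complex.exp (t * (∑ l, Y l w : ℝ) * Complex.I) ∂P := by
    refine integral_congr_ae ?_
    filter_upwards [hsumZY] with w hw
    rw [hw]
    push_cast
    rfl
  rw [h4, ← h3]
  congr 1
  push_cast
  ring

theorem integral_exp_sum_mul_I_of_mem_closure (hG : ∀ l, IsGaussianProcess (X l) P)
    (hmean : ∀ l x, ∫ w, X l x w ∂P = 0)
    (hind : iIndepFun (fun l w x => X l x w) P) (Z : Fin ℓ → Lp ℝ 2 P)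
    (hZ : ∀ l, Z l ∈ (Submodule.span ℝ
      (Set.range fun x => (memLp_two_of_isGaussianProcess (hG l) x).toLp)).topologicalClosure)
    (t : ℝ) :
    ∫ w, Complex.exp ((t * (∑ l, Z l : Lp ℝ 2 P) w : ℝ) * Complex.I) ∂P =
      Complex.exp (-(t ^ 2 * ∑ l, ‖Z l‖ ^ 2) / 2 : ℝ) := by
  let V : Fin ℓ → Set (Lp ℝ 2 P) := fun l => (Submodule.span ℝ
      (Set.range fun x => (memLp_two_of_isGaussianProcess (hG l) x).toLp) : Set (Lp ℝ 2 P))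
  have hcl : IsClosed {Z : Fin ℓ → Lp ℝ 2 P |
      ∫ w, Complex.exp ((t * (∑ l, Z l : Lp ℝ 2 P) w : ℝ) * Complex.I) ∂P =
        Complex.exp (-(t ^ 2 * ∑ l, ‖Z l‖ ^ 2) / 2 : ℝ)} := by
    refine isClosed_eq ?_ ?_
    · exact (continuous_integral_exp_mul_I t).comp
        (by fun_prop : Continuous fun Z : Fin ℓ → Lp ℝ 2 P => ∑ l, Z l)
    · fun_prop
  have hsub : Set.univ.pi V ⊆ {Z : Fin ℓ → Lp ℝ 2 P |
      ∫ w, Complex.exp ((t * (∑ l, Z l : Lp ℝ 2 P) w : ℝ) * Complex.I) ∂P =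
        Complex.exp (-(t ^ 2 * ∑ l, ‖Z l‖ ^ 2) / 2 : ℝ)} := fun Z hZ =>
    integral_exp_sum_mul_I_of_mem_span hG hmean hind Z (fun l => hZ l (Set.mem_univ l)) t
  -- The identity holds on the product of the spans and is a closed condition; the closure of that
  -- product is the product of the closures.
  refine closure_minimal hsub hcl ?_
  rw [closure_pi_set]
  exact fun l _ => hZ l

/-- Sums of independent elements of the closed linear spans of centered Gaussian processes are
centered Gaussian variables. -/
theorem map_sum_eq_gaussianReal_of_mem_closure (hG : ∀ l, IsGaussianProcess (X l) P)
    (hmean : ∀ l x, ∫ w, X l x w ∂P = 0)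
    (hind : iIndepFun (fun l w x => X l x w) P) {f : Fin ℓ → S → ℝ} (hf : ∀ l, MemLp (f l) 2 P)
    (hfX : ∀ l, (hf l).toLp ∈ (Submodule.span ℝ
      (Set.range fun x => (memLp_two_of_isGaussianProcess (hG l) x).toLp)).topologicalClosure) :
    P.map (fun w => ∑ l, f l w) = gaussianReal 0 (∑ l, ∫ w, f l w ^ 2 ∂P).toNNReal := by
  have hm : AEMeasurable (fun w => ∑ l, f l w) P :=
    Finset.aemeasurable_fun_sum _ fun l _ => (hf l).aestronglyMeasurable.aemeasurable
  have hP := Measure.isProbabilityMeasure_map hm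
  have hnorm : ∀ l, ‖(hf l).toLp‖ ^ 2 = ∫ w, f l w ^ 2 ∂P := by
    intro l
    rw [Lp_two_norm_sq_eq_integral]
    refine integral_congr_ae ?_
    filter_upwards [(hf l).coeFn_toLp] with w hw
    rw [hw]
  have hsum : (∑ l, (hf l).toLp : Lp ℝ 2 P) =ᵐ[P] fun w => ∑ l, f l w := by
    refine (Lp.coeFn_finsetSum _ _).trans ?_
    filter_upwards [ae_all_iff.2 fun l => (hf l).coeFn_toLp] with w hw
    rw [Finset.sum_apply]
    exact Finset.sum_congr rfl fun l _ => hw l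
  apply Measure.ext_of_charFun
  ext t
  have h := integral_exp_sum_mul_I_of_mem_closure hG hmean hind _ hfX t
  rw [charFun_gaussianReal, charFun_apply_real, integral_map hm (by fun_prop),
    Real.coe_toNNReal _ (Finset.sum_nonneg fun l _ => integral_nonneg fun w => sq_nonneg _)]
  simp_rw [hnorm] at h
  have h4 : ∫ w, Complex.exp (t * (∑ l, f l w : ℝ) * Complex.I) ∂P =
      ∫ w, Complex.exp ((t * (∑ l, (hf l).toLp : Lp ℝ 2 P) w : ℝ) * Complex.I) ∂P := by
    refine integral_congr_ae ?_
    filter_upwards [hsum] with w hw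
    rw [hw]
    push_cast
    rfl
  rw [h4, h]
  congr 1
  push_cast
  ring

end GaussianClosure

/-! ### Random elements of `L²` given by the paths of a process -/

section Paths

variable {α : Type*} [MeasurableSpace α] {μ : Measure α}
  {S : Type*} [MeasurableSpace S] {P : Measure S}
  {X : α → S → ℝ} {W : S → Lp ℝ 2 μ}

theorem ae_inner_eq_integral (hWX : ∀ᵐ w ∂P, (W w : α → ℝ) =ᵐ[μ] fun x => X x w)
    (h : Lp ℝ 2 μ) : ∀ᵐ w ∂P, inner ℝ h (W w) = ∫ x, h x * X x w ∂μ := by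
  filter_upwards [hWX] with w hw
  rw [L2.inner_def]
  refine integral_congr_ae ?_
  filter_upwards [hw] with x hx
  rw [hx]
  simp [mul_comm]

theorem ae_enorm_sq_eq_lintegral (hWX : ∀ᵐ w ∂P, (W w : α → ℝ) =ᵐ[μ] fun x => X x w) :
    ∀ᵐ w ∂P, ‖W w‖ₑ ^ 2 = ∫⁻ x, ‖X x w‖ₑ ^ 2 ∂μ := by
  filter_upwards [hWX] with w hw
  rw [Lp.enorm_def, eLpNorm_congr_ae hw, eLpNorm_eq_lintegral_rpow_enorm_toReal two_ne_zero
    (by simp), ← ENNReal.rpow_natCast, ← ENNReal.rpow_mul]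
  simp

theorem memLp_uncurry [IsProbabilityMeasure P] (hX : Measurable (Function.uncurry X))
    (hfin : ∫⁻ x, ∫⁻ w, ‖X x w‖ₑ ^ 2 ∂P ∂μ < ∞) : MemLp (Function.uncurry X) 2 (μ.prod P) := by
  refine ⟨hX.aestronglyMeasurable, ?_⟩
  rw [eLpNorm_lt_top_iff_lintegral_rpow_enorm_lt_top two_ne_zero (by simp)]
  simp only [ENNReal.toReal_ofNat, ENNReal.rpow_ofNat]
  rw [lintegral_prod _ (by fun_prop)]
  exact hfin

theorem integrable_mul_uncurry_mul [IsProbabilityMeasure P] (hX : Measurable (Function.uncurry X))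
    (hfin : ∫⁻ x, ∫⁻ w, ‖X x w‖ₑ ^ 2 ∂P ∂μ < ∞) {h : α → ℝ} (hh : MemLp h 2 μ) {Y : S → ℝ}
    (hY : MemLp Y 2 P) :
    Integrable (fun z : α × S => h z.1 * (X z.1 z.2 * Y z.2)) (μ.prod P) := by
  have h1 : MemLp (fun z : α × S => h z.1 * Y z.2) 2 (μ.prod P) := by
    rw [memLp_two_iff_integrable_sq
      (hh.aestronglyMeasurable.comp_fst.fun_mul hY.aestronglyMeasurable.comp_snd)]
    simp_rw [mul_pow]
    exact hh.integrable_sq.mul_prod hY.integrable_sq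
  refine ((memLp_uncurry hX hfin).integrable_mul h1).congr (Filter.Eventually.of_forall fun z => ?_)
  simp only [Pi.mul_apply, Function.uncurry_def]
  ring

/-- Joint measurability of the process makes each pairing with a fixed element measurable; `W` is
the limit of its expansions in the countable basis. -/
theorem aestronglyMeasurable_of_paths [SigmaFinite μ] (hX : Measurable (Function.uncurry X))
    (hWX : ∀ᵐ w ∂P, (W w : α → ℝ) =ᵐ[μ] fun x => X x w) (e : HilbertBasis ℕ ℝ (Lp ℝ 2 μ)) :
    AEStronglyMeasurable W P := by
  have h1 : ∀ h : Lp ℝ 2 μ, AEStronglyMeasurable (fun w => inner ℝ h (W w)) P := by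
    intro h
    have h2 : AEStronglyMeasurable (fun w => ∫ x, h x * X x w ∂μ) P := by
      have h3 : StronglyMeasurable fun z : S × α => h z.2 * X z.2 z.1 :=
        ((Lp.stronglyMeasurable h).comp_measurable measurable_snd).mul
          (hX.comp measurable_swap).stronglyMeasurable
      exact h3.integral_prod_right.aestronglyMeasurable
    refine h2.congr ?_
    filter_upwards [ae_inner_eq_integral hWX h] with w hw
    exact hw.symm
  refine aestronglyMeasurable_of_tendsto_ae Filter.atTop
    (f := fun (n : ℕ) w => ∑ j ∈ Finset.range n, (inner ℝ (e j) (W w) : ℝ) • e j)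
    (fun n => Finset.aestronglyMeasurable_fun_sum _ fun j _ => (h1 (e j)).smul_const _)
    (Filter.Eventually.of_forall fun w => ?_)
  have h4 := (e.hasSum_repr (W w)).tendsto_sum_nat
  simpa only [e.repr_apply_apply] using h4

variable [SigmaFinite μ] [IsProbabilityMeasure P]

theorem lintegral_enorm_sq_of_paths (hX : Measurable (Function.uncurry X))
    (hWX : ∀ᵐ w ∂P, (W w : α → ℝ) =ᵐ[μ] fun x => X x w) :
    ∫⁻ w, ‖W w‖ₑ ^ 2 ∂P = ∫⁻ x, ∫⁻ w, ‖X x w‖ₑ ^ 2 ∂P ∂μ := by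
  rw [lintegral_congr_ae (ae_enorm_sq_eq_lintegral hWX)]
  refine lintegral_lintegral_swap ?_
  have := (hX.comp measurable_swap).enorm.pow_const 2
  exact this.aemeasurable

theorem memLp_of_paths (hX : Measurable (Function.uncurry X))
    (hfin : ∫⁻ x, ∫⁻ w, ‖X x w‖ₑ ^ 2 ∂P ∂μ < ∞)
    (hWX : ∀ᵐ w ∂P, (W w : α → ℝ) =ᵐ[μ] fun x => X x w) (e : HilbertBasis ℕ ℝ (Lp ℝ 2 μ)) :
    MemLp W 2 P := by
  refine ⟨aestronglyMeasurable_of_paths hX hWX e, ?_⟩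
  rw [eLpNorm_lt_top_iff_lintegral_rpow_enorm_lt_top two_ne_zero (by simp)]
  simp only [ENNReal.toReal_ofNat, ENNReal.rpow_ofNat]
  rwa [lintegral_enorm_sq_of_paths hX hWX]

theorem integral_inner_mul_of_paths (hX : Measurable (Function.uncurry X))
    (hfin : ∫⁻ x, ∫⁻ w, ‖X x w‖ₑ ^ 2 ∂P ∂μ < ∞)
    (hWX : ∀ᵐ w ∂P, (W w : α → ℝ) =ᵐ[μ] fun x => X x w) (h : Lp ℝ 2 μ) {Y : S → ℝ}
    (hY : MemLp Y 2 P) :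
    ∫ w, inner ℝ h (W w) * Y w ∂P = ∫ x, h x * ∫ w, X x w * Y w ∂P ∂μ := by
  calc _ = ∫ w, ∫ x, h x * (X x w * Y w) ∂μ ∂P := by
        refine integral_congr_ae ?_
        filter_upwards [ae_inner_eq_integral hWX h] with w hw
        rw [hw, ← integral_mul_const]
        simp_rw [mul_assoc]
    _ = ∫ x, ∫ w, h x * (X x w * Y w) ∂P ∂μ :=
        (integral_integral_swap (integrable_mul_uncurry_mul hX hfin (Lp.memLp h) hY)).symm
    _ = _ := by simp_rw [integral_const_mul]

/-- The `L²` pairings of the paths of a process lie in its closed linear span. -/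
theorem toLp_inner_mem_closure (hX : Measurable (Function.uncurry X))
    (hfin : ∫⁻ x, ∫⁻ w, ‖X x w‖ₑ ^ 2 ∂P ∂μ < ∞)
    (hWX : ∀ᵐ w ∂P, (W w : α → ℝ) =ᵐ[μ] fun x => X x w) (hX2 : ∀ x, MemLp (X x) 2 P)
    {h : Lp ℝ 2 μ} (hh : MemLp (fun w => inner ℝ h (W w)) 2 P) :
    hh.toLp ∈ (Submodule.span ℝ (Set.range fun x => (hX2 x).toLp)).topologicalClosure := by
  -- Membership in the closure is tested against each `Y` orthogonal to all the `X x`, and Fubini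
  -- moves the expectation inside the pairing.
  rw [← Submodule.orthogonal_orthogonal_eq_closure]
  intro Y hY
  have hY0 : ∀ x, ∫ w, X x w * Y w ∂P = 0 := by
    intro x
    have h1 := hY _ (Submodule.subset_span (Set.mem_range_self x))
    rw [L2.inner_def] at h1
    rw [← h1]
    refine integral_congr_ae ?_
    filter_upwards [(hX2 x).coeFn_toLp] with w hw
    rw [hw]
    simp [mul_comm]
  have h2 := integral_inner_mul_of_paths hX hfin hWX h (Lp.memLp Y)
  simp_rw [hY0] at h2
  rw [real_inner_comm, L2.inner_def]
  simp only [mul_zero, integral_zero] at h2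
  rw [← h2]
  refine integral_congr_ae ?_
  filter_upwards [hh.coeFn_toLp] with w hw
  rw [hw]
  simp [mul_comm]

end Paths

/-- The second moment form of a square integrable random vector. -/
noncomputable def secondMoment {H S : Type*} [NormedAddCommGroup H] [InnerProductSpace ℝ H]
    [MeasurableSpace S] {P : Measure S} {W : S → H} (hW : MemLp W 2 P) :
    LinearMap.BilinForm ℝ H :=
  have hint : ∀ x y : H, Integrable (fun w => inner ℝ x (W w) * inner ℝ y (W w)) P := fun x y =>
    (hW.const_inner x).integrable_mul (hW.const_inner y)
  LinearMap.mk₂ ℝ (fun x y => ∫ w, inner ℝ x (W w) * inner ℝ y (W w) ∂P)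
    (fun x x' y => by
      rw [← integral_add (hint x y) (hint x' y)]
      simp_rw [inner_add_left, add_mul])
    (fun c x y => by
      rw [smul_eq_mul, ← integral_const_mul]
      simp [inner_smul_left, mul_assoc])
    (fun x y y' => by
      rw [← integral_add (hint x y) (hint x y')]
      simp_rw [inner_add_left, mul_add])
    (fun c x y => by
      rw [smul_eq_mul, ← integral_const_mul]
      simp [inner_smul_left, mul_left_comm])

section SecondMoment

variable {H S : Type*} [NormedAddCommGroup H] [InnerProductSpace ℝ H]
    [MeasurableSpace S] {P : Measure S} {W : S → H}

theorem secondMoment_apply (hW : MemLp W 2 P) (x y : H) :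
    secondMoment hW x y = ∫ w, inner ℝ x (W w) * inner ℝ y (W w) ∂P := rfl

theorem abs_secondMoment_le (hW : MemLp W 2 P) (x y : H) :
    |secondMoment hW x y| ≤ (∫ w, ‖W w‖ ^ 2 ∂P) * ‖x‖ * ‖y‖ := by
  rw [secondMoment_apply, ← integral_mul_const, ← integral_mul_const, ← Real.norm_eq_abs]
  refine norm_integral_le_of_norm_le
    ((((memLp_two_iff_integrable_sq_norm hW.aestronglyMeasurable).1 hW).mul_const _).mul_const _)
    (Filter.Eventually.of_forall fun w => ?_)
  rw [norm_mul]
  calc _ ≤ (‖x‖ * ‖W w‖) * (‖y‖ * ‖W w‖) := by gcongr <;> exact norm_inner_le_norm _ _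
    _ = _ := by ring

theorem continuous_secondMoment_self (hW : MemLp W 2 P) :
    Continuous fun x => secondMoment hW x x := by
  let B := (secondMoment hW).mkContinuous₂ (∫ w, ‖W w‖ ^ 2 ∂P) (abs_secondMoment_le hW)
  exact (by fun_prop : Continuous fun x => B x x)

/-- If the second moment form is diagonal in a complete orthonormal basis, its quadratic form is
bounded by the largest diagonal value. -/
theorem secondMoment_self_le (hW : MemLp W 2 P) (ψ : HilbertBasis ℕ ℝ H) {lam : ℕ → ℝ}
    (hlam : Antitone lam)
    (hψ : ∀ i j, secondMoment hW (ψ i) (ψ j) = if i = j then lam j else 0) (x : H) :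
    secondMoment hW x x ≤ lam 0 * ‖x‖ ^ 2 := by
  have hcl : IsClosed {x | secondMoment hW x x ≤ lam 0 * ‖x‖ ^ 2} :=
    isClosed_le (continuous_secondMoment_self hW) (by fun_prop)
  refine hcl.mem_of_tendsto (ψ.hasSum_repr x).tendsto_sum_nat
    (Filter.Eventually.of_forall fun n => ?_)
  rw [Set.mem_ofPred_eq]
  have h1 : secondMoment hW (∑ i ∈ Finset.range n, ψ.repr x i • ψ i)
      (∑ i ∈ Finset.range n, ψ.repr x i • ψ i) =
      ∑ i ∈ Finset.range n, ψ.repr x i ^ 2 * lam i := by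
    simp only [map_sum, LinearMap.sum_apply, map_smul, LinearMap.smul_apply, hψ, smul_eq_mul]
    refine Finset.sum_congr rfl fun i hi => ?_
    rw [Finset.sum_eq_single i (fun j _ hj => by simp [hj]) fun h => absurd hi h]
    simp
    ring
  have h2 : ‖∑ i ∈ Finset.range n, ψ.repr x i • ψ i‖ ^ 2 =
      ∑ i ∈ Finset.range n, ψ.repr x i ^ 2 := by
    rw [← real_inner_self_eq_norm_sq, ψ.orthonormal.inner_sum]
    simp [sq]
  rw [h1, h2, Finset.mul_sum]
  refine Finset.sum_le_sum fun i _ => ?_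
  rw [mul_comm]
  gcongr
  exact hlam (Nat.zero_le i)

/-- Bessel's inequality under the expectation. Applied to an eigenbasis it gives summability of the
eigenvalues without Mercer's theorem. -/
theorem sum_secondMoment_le (hW : MemLp W 2 P) (ψ : HilbertBasis ℕ ℝ H) (n : ℕ) :
    ∑ i ∈ Finset.range n, secondMoment hW (ψ i) (ψ i) ≤ ∫ w, ‖W w‖ ^ 2 ∂P := by
  simp_rw [secondMoment_apply]
  have hint : ∀ i, Integrable (fun w => inner ℝ (ψ i) (W w) * inner ℝ (ψ i) (W w)) P := fun i =>
    (hW.const_inner (ψ i)).integrable_mul (hW.const_inner (ψ i))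
  rw [← integral_finsetSum _ fun i _ => hint i]
  refine integral_mono (integrable_finsetSum _ fun i _ => hint i)
    ((memLp_two_iff_integrable_sq_norm hW.aestronglyMeasurable).1 hW) fun w => ?_
  have := ψ.orthonormal.sum_inner_products_le (W w) (s := Finset.range n)
  refine le_trans (le_of_eq ?_) this
  simp [sq]

end SecondMoment

/-! ### Covariance kernels -/

section Covariance

variable {d : ℕ} {D : Set (Pt d)}

theorem sigmaFinite_leb (hD : MeasurableSet D) : SigmaFinite (leb D) := by
  refine SigmaFinite.of_map (leb D) (f := Subtype.val) measurable_subtype_coe.aemeasurable ?_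
  rw [map_comap_subtype_coe hD]
  infer_instance

namespace IsPosDefKernel

variable {K : D → D → ℝ}

theorem diag_nonneg (hK : IsPosDefKernel K) (x : D) : 0 ≤ K x x := by
  simpa using hK.posSemidef 1 (fun _ => x) (fun _ => 1)

/-- Positivity on two points makes a quadratic polynomial nonnegative, so its discriminant is
nonpositive. -/
theorem abs_le (hK : IsPosDefKernel K) (x y : D) : |K x y| ≤ √(K x x) * √(K y y) := by
  have h : ∀ c : ℝ, 0 ≤ K x x * (c * c) + 2 * K x y * c + K y y := by
    intro c
    have h1 := hK.posSemidef 2 ![x, y] ![c, 1]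
    simp only [Fin.sum_univ_two, Matrix.cons_val_zero, Matrix.cons_val_one, hK.symm y x] at h1
    linarith
  have h2 := discrim_le_zero h
  rw [← Real.sqrt_mul (hK.diag_nonneg x)]
  refine Real.abs_le_sqrt ?_
  rw [discrim] at h2
  linarith

/-- The finite trace puts `√(K x x)` in `L²`, so the integrand is dominated by a product of two
integrable functions of one variable. -/
theorem integrable_mul_mul [SigmaFinite (leb D)] (hK : IsPosDefKernel K)
    (htr : Integrable (fun x : D => K x x) (leb D)) (f g : L2 D) :
    Integrable (fun z : D × D => f z.1 * K z.1 z.2 * g z.2) ((leb D).prod (leb D)) := by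
  have hdiag : Continuous fun x : D => K x x := hK.continuous.comp (by fun_prop : Continuous
    fun x : D => (x, x))
  have hsqrt : MemLp (fun x : D => √(K x x)) 2 (leb D) := by
    rw [memLp_two_iff_integrable_sq hdiag.sqrt.aestronglyMeasurable]
    simpa only [Real.sq_sqrt (hK.diag_nonneg _)] using htr
  have hf := (Lp.memLp f).integrable_mul hsqrt
  have hg := (Lp.memLp g).integrable_mul hsqrt
  refine (hf.mul_prod hg).mono ?_ (Filter.Eventually.of_forall fun z => ?_)
  · exact ((Lp.aestronglyMeasurable f).comp_fst.mul
      hK.continuous.aestronglyMeasurable).mul (Lp.aestronglyMeasurable g).comp_snd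
  · simp only [Pi.mul_apply, norm_mul, Real.norm_eq_abs, abs_of_nonneg (Real.sqrt_nonneg _)]
    calc _ ≤ |f z.1| * (√(K z.1 z.1) * √(K z.2 z.2)) * |g z.2| := by
          gcongr
          exact hK.abs_le _ _
      _ = _ := by ring

theorem kernelForm_eq [SigmaFinite (leb D)] (hK : IsPosDefKernel K)
    (htr : Integrable (fun x : D => K x x) (leb D)) (f g : L2 D) :
    kernelForm K f g = ∫ x, f x * ∫ y, K x y * g y ∂(leb D) ∂(leb D) := by
  rw [kernelForm, integral_prod _ (hK.integrable_mul_mul htr f g)]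
  simp_rw [mul_assoc, integral_const_mul]

theorem kernelForm_eigen [SigmaFinite (leb D)] (hK : IsPosDefKernel K)
    (htr : Integrable (fun x : D => K x x) (leb D)) {lam : ℕ → ℝ} {ψ : HilbertBasis ℕ ℝ (L2 D)}
    (hψ : ∀ j, ∀ᵐ x ∂(leb D), ∫ y, K x y * ψ j y ∂(leb D) = lam j * ψ j x) (i j : ℕ) :
    kernelForm K (ψ i) (ψ j) = if i = j then lam j else 0 := by
  have h1 : kernelForm K (ψ i) (ψ j) = lam j * inner ℝ (ψ i) (ψ j) := by
    rw [hK.kernelForm_eq htr, L2.inner_def, ← integral_const_mul]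
    refine integral_congr_ae ?_
    filter_upwards [hψ j] with x hx
    rw [hx]
    simp
    ring
  rw [h1, orthonormal_iff_ite.1 ψ.orthonormal]
  split_ifs <;> simp

end IsPosDefKernel

variable {K : D → D → ℝ} {S : Type*} [MeasurableSpace S] {P : Measure S}
  {X : D → S → ℝ} {W : S → L2 D}

namespace IsCenteredGP

theorem memLp_two (hX : IsCenteredGP K P X) (x : D) : MemLp (X x) 2 P :=
  memLp_two_of_isGaussianProcess hX.gaussian x

variable [IsProbabilityMeasure P]

theorem integral_mul (hX : IsCenteredGP K P X) (x y : D) :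
    ∫ w, X x w * X y w ∂P = K x y := by
  rw [← hX.cov, covariance_eq_sub (hX.memLp_two x) (hX.memLp_two y), hX.mean, zero_mul, sub_zero]
  rfl

theorem lintegral_enorm_sq (hX : IsCenteredGP K P X) (x : D) :
    ∫⁻ w, ‖X x w‖ₑ ^ 2 ∂P = ENNReal.ofReal (K x x) := by
  have hint : Integrable (fun w => X x w * X x w) P :=
    (hX.memLp_two x).integrable_mul (hX.memLp_two x)
  rw [← hX.integral_mul x x, ofReal_integral_eq_lintegral_ofReal hint
    (Filter.Eventually.of_forall fun w => mul_self_nonneg _)]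
  refine lintegral_congr fun w => ?_
  rw [enorm_sq_eq_ofReal, Real.norm_eq_abs, sq_abs, sq]

theorem lintegral_lintegral_enorm_sq_lt_top (hX : IsCenteredGP K P X)
    (htr : Integrable (fun x : D => K x x) (leb D)) :
    ∫⁻ x, ∫⁻ w, ‖X x w‖ₑ ^ 2 ∂P ∂(leb D) < ∞ := by
  simp_rw [hX.lintegral_enorm_sq]
  exact htr.lintegral_lt_top

/-- Fubini is applied twice, once for each factor, until only `𝔼 X x X y = K x y` remains. -/
theorem secondMoment_eq [SigmaFinite (leb D)] (hX : IsCenteredGP K P X) (hK : IsPosDefKernel K)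
    (htr : Integrable (fun x : D => K x x) (leb D))
    (hWX : ∀ᵐ w ∂P, (W w : D → ℝ) =ᵐ[leb D] fun x => X x w) (hW : MemLp W 2 P) (f g : L2 D) :
    secondMoment hW f g = kernelForm K f g := by
  have hfin := hX.lintegral_lintegral_enorm_sq_lt_top htr
  rw [secondMoment_apply, hK.kernelForm_eq htr,
    integral_inner_mul_of_paths hX.measurable hfin hWX f (hW.const_inner g)]
  have h1 : ∀ x, ∫ w, X x w * inner ℝ g (W w) ∂P = ∫ y, K x y * g y ∂(leb D) := by
    intro x
    simp_rw [mul_comm (X x _)]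
    rw [integral_inner_mul_of_paths hX.measurable hfin hWX g (hX.memLp_two x)]
    refine integral_congr_ae (Filter.Eventually.of_forall fun y => ?_)
    simp only [hX.integral_mul, hK.symm y x]
    ring
  simp_rw [h1]

end IsCenteredGP

variable [IsProbabilityMeasure P]

/-- The columns of a Gaussian quasimatrix form a Gaussian sample with the covariance form of the
kernel. -/
theorem isGaussianSample_of_isGPQuasimatrix [SigmaFinite (leb D)] (hK : IsPosDefKernel K)
    (htr : Integrable (fun x : D => K x x) (leb D)) (e : HilbertBasis ℕ ℝ (L2 D)) {ℓ : ℕ}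
    {W : Fin ℓ → S → L2 D} (hW : IsGPQuasimatrix K P W) (l₀ : Fin ℓ) :
    ∃ hW₀ : MemLp (W l₀) 2 P, IsGaussianSample (secondMoment hW₀) P W ∧
      ∀ f g, secondMoment hW₀ f g = kernelForm K f g := by
  obtain ⟨X, hX, hind, hWX⟩ := hW
  have hfin := fun l => (hX l).lintegral_lintegral_enorm_sq_lt_top htr
  have hW2 : ∀ l, MemLp (W l) 2 P := fun l =>
    memLp_of_paths (hX l).measurable (hfin l) (hWX l) e
  have hker : ∀ l f g, secondMoment (hW2 l) f g = kernelForm K f g := fun l =>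
    (hX l).secondMoment_eq hK htr (hWX l) (hW2 l)
  refine ⟨hW2 l₀, ⟨fun x => ?_, fun x y => ?_, fun l => (hW2 l).aestronglyMeasurable,
    fun h => ?_⟩, hker l₀⟩
  · exact integral_nonneg fun w => mul_self_nonneg _
  · simp_rw [secondMoment_apply, mul_comm]
  · have h1 := map_sum_eq_gaussianReal_of_mem_closure (fun l => (hX l).gaussian)
      (fun l => (hX l).mean) hind (f := fun l w => inner ℝ (h l) (W l w))
      (fun l => (hW2 l).const_inner (h l))
      fun l => toLp_inner_mem_closure (hX l).measurable (hfin l) (hWX l) _ _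
    rw [h1]
    congr 2
    refine Finset.sum_congr rfl fun l _ => ?_
    -- Every column has the same second moment form, determined by `K`, so the one of the reference
    -- column `l₀` serves for all.
    rw [hker l₀, ← hker l, secondMoment_apply]
    simp_rw [sq]

theorem posDef_covMatrix {B : LinearMap.BilinForm ℝ (L2 D)} (hB : ∀ f g, B f g = kernelForm K f g)
    (hsymm : ∀ f g, B f g = B g f) (hK : IsPosDefKernel K) {v : ℕ → L2 D} (hv : Orthonormal ℝ v)
    (k : ℕ) : (covMatrix K v k).PosDef := by
  refine Matrix.PosDef.of_dotProduct_mulVec_pos ?_ fun x hx => ?_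
  · ext i j
    simp [covMatrix, ← hB, hsymm (v j)]
  · have h1 : star x ⬝ᵥ (covMatrix K v k).mulVec x = B (∑ i, x i • v i) (∑ i, x i • v i) := by
      simp only [map_sum, LinearMap.sum_apply, map_smul, LinearMap.smul_apply, smul_eq_mul,
        dotProduct, Matrix.mulVec, covMatrix, Matrix.of_apply, ← hB, Pi.star_apply, star_trivial]
      refine Finset.sum_congr rfl fun i _ => congrArg _ (Finset.sum_congr rfl fun j _ => ?_)
      rw [hsymm, mul_comm]
    rw [h1, hB]
    refine hK.posDef _ fun h0 => hx ?_
    have hli := (hv.linearIndependent.comp _ Fin.val_injective : LinearIndependent ℝ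
      fun i : Fin k => v i)
    exact funext (Fintype.linearIndependent_iff.1 hli x h0)

end Covariance

end RandSVD

/-! ### The theorem for Gaussian processes with covariance kernel `K`. -/

theorem theorem1 {d : ℕ} {D₁ D₂ : Set (RandSVD.Pt d)}
    (hD₁ : MeasurableSet D₁) (hD₂ : MeasurableSet D₂)
    -- a Hilbert–Schmidt operator and a singular value decomposition of it
    (e : HilbertBasis ℕ ℝ (RandSVD.L2 D₁))
    (F : RandSVD.L2 D₁ →L[ℝ] RandSVD.L2 D₂) (hF : RandSVD.IsHilbertSchmidt e F)
    (σ : ℕ → ℝ) (v : ℕ → RandSVD.L2 D₁) (u : ℕ → RandSVD.L2 D₂)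
    (hsvd : RandSVD.IsSVD F σ v u)
    -- a kernel of finite trace and its eigenvalues
    (K : D₁ → D₁ → ℝ) (hK : RandSVD.IsPosDefKernel K)
    (htr : Integrable (fun x : D₁ => K x x) (RandSVD.leb D₁))
    (lam : ℕ → ℝ) (hlam : RandSVD.IsEigenvalueSeq K lam)
    -- target rank and oversampling parameter
    (k p : ℕ) (hk : 1 ≤ k) (hp : 2 ≤ p)
    -- the random quasimatrix
    {S : Type*} [MeasurableSpace S] (P : Measure S) [IsProbabilityMeasure P]
    (W : Fin (k + p) → S → RandSVD.L2 D₁) (hW : RandSVD.IsGPQuasimatrix K P W) :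
    -- the quantities in the bounds are well defined
    (Summable lam ∧ (∀ j, 0 < lam j) ∧ Summable (fun j => σ j ^ 2) ∧
      (RandSVD.covMatrix K v k).PosDef) ∧
    -- bound in expectation
    (Integrable (fun w => RandSVD.svdError e F fun j => W j w) P ∧
      ∫ w, RandSVD.svdError e F (fun j => W j w) ∂P ≤
        (1 + Real.sqrt (1 / RandSVD.quality K lam v k *
            ((k : ℝ) * ((k : ℝ) + (p : ℝ)) / ((p : ℝ) - 1)))) *
          Real.sqrt (∑' j, σ (k + j) ^ 2)) ∧
    -- bound in probability
    (4 ≤ p → ∀ s t : ℝ, 1 ≤ s → 1 ≤ t →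
      1 - (t ^ p)⁻¹ - (s * Real.exp (-(s ^ 2 - 1) / 2)) ^ (k + p) ≤
        P.real {w | RandSVD.svdError e F (fun j => W j w) ≤
          Real.sqrt (1 + t ^ 2 * s ^ 2 * (3 / RandSVD.quality K lam v k) *
              ((k : ℝ) * ((k : ℝ) + (p : ℝ)) / ((p : ℝ) + 1)) *
              ∑' j, lam j / lam 0) *
            Real.sqrt (∑' j, σ (k + j) ^ 2)}) := by
  have := RandSVD.sigmaFinite_leb hD₁
  obtain ⟨hW₀, hsample, hB⟩ :=
    RandSVD.isGaussianSample_of_isGPQuasimatrix hK htr e hW ⟨0, by omega⟩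
  obtain ⟨hanti, ψ, hψ⟩ := hlam
  set B := RandSVD.secondMoment hW₀ with hBdef
  have hv := hsvd.orthonormal_right
  have hBψ : ∀ i j, B (ψ i) (ψ j) = if i = j then lam j else 0 := fun i j => by
    rw [hB, hK.kernelForm_eigen htr hψ]
  have hBpos : ∀ f, f ≠ 0 → 0 < B f f := fun f hf => by
    rw [hB]
    exact hK.posDef f hf
  have hlampos : ∀ j, 0 < lam j := fun j => by
    have h := hBpos (ψ j) (ψ.orthonormal.ne_zero j)
    rwa [hBψ, if_pos rfl] at h
  have hlamsum : Summable lam := by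
    refine summable_of_sum_range_le (c := ∫ w, ‖W ⟨0, by omega⟩ w‖ ^ 2 ∂P)
      (fun j => (hlampos j).le) fun n => ?_
    have h := RandSVD.sum_secondMoment_le hW₀ ψ n
    simpa only [← hBdef, hBψ, if_true] using h
  have hΛ : ∀ f, B f f ≤ lam 0 * ‖f‖ ^ 2 := RandSVD.secondMoment_self_le hW₀ ψ hanti hBψ
  have hC : (RandSVD.covMatrix K v k).PosDef :=
    RandSVD.posDef_covMatrix hB hsample.symm hK hv k
  have hCB : ∀ i j : Fin k, RandSVD.covMatrix K v k i j = B (v i) (v j) := fun i j => by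
    rw [hB, RandSVD.covMatrix, Matrix.of_apply]
  have htrC : 0 < (RandSVD.covMatrix K v k)⁻¹.trace := by
    have : Nonempty (Fin k) := ⟨⟨0, hk⟩⟩
    exact hC.inv.trace_pos
  have hlam0 := hlampos 0
  have hk0 : (0 : ℝ) < k := by exact_mod_cast hk
  have hτ0 : 0 ≤ ∑' j, σ (k + j) ^ 2 := tsum_nonneg fun _ => sq_nonneg _
  refine ⟨⟨hlamsum, hlampos, hsvd.summable_sq hF, hC⟩, ⟨hsample.integrable_svdError hF, ?_⟩, ?_⟩
  · have hp1 : (0 : ℝ) < (p : ℝ) - 1 := by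
      have : (2 : ℝ) ≤ p := by exact_mod_cast hp
      linarith
    refine (hsample.integral_svdError_le hp hsvd hF hΛ hCB hC).trans_eq ?_
    rw [add_mul, one_mul, ← Real.sqrt_mul' _ hτ0, RandSVD.quality]
    congr 2
    push_cast
    field_simp
  · intro hp4 s t hs ht
    refine (hsample.one_sub_le_measureReal_svdError_le hk hp4 hsvd hF hΛ
      (fun j => hBpos _ (hv.ne_zero j)) hCB hC hs ht).trans (measureReal_mono fun w hw => ?_)
    rw [Set.mem_ofPred_eq] at hw ⊢
    refine hw.trans ?_
    rw [← Real.sqrt_mul' _ hτ0]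
    refine Real.sqrt_le_sqrt ?_
    -- The sample bound holds without the factor `∑ λ_j / λ₁`; since this factor is at least 1,
    -- inserting it only enlarges the right side.
    have hone : 1 ≤ ∑' j, lam j / lam 0 := by
      have h := (hlamsum.div_const (lam 0)).le_tsum 0 fun j _ => (div_pos (hlampos j) hlam0).le
      rwa [div_self hlam0.ne'] at h
    set τ := ∑' j, σ (k + j) ^ 2
    set A := (RandSVD.covMatrix K v k)⁻¹.trace
    have hq : 3 / RandSVD.quality K lam v k * ((k : ℝ) * ((k : ℝ) + (p : ℝ)) / ((p : ℝ) + 1)) =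
        A * (3 / ((p : ℝ) + 1)) * (((k + p : ℕ) : ℝ) * lam 0) := by
      rw [RandSVD.quality]
      change _ / ((k : ℝ) / (lam 0 * A)) * _ = _
      push_cast
      field_simp
    have hq0 : 0 ≤ t ^ 2 * s ^ 2 * (A * (3 / ((p : ℝ) + 1)) * (((k + p : ℕ) : ℝ) * lam 0)) := by
      positivity
    calc _ = (1 + t ^ 2 * s ^ 2 * (A * (3 / ((p : ℝ) + 1)) * (((k + p : ℕ) : ℝ) * lam 0)) * 1) *
          τ := by ring
      _ ≤ (1 + t ^ 2 * s ^ 2 * (A * (3 / ((p : ℝ) + 1)) * (((k + p : ℕ) : ℝ) * lam 0)) *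
          ∑' j, lam j / lam 0) * τ := by gcongr
      _ = _ := by rw [← hq]; ring
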